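/- **Setting.** Let $M\ge 1$ and $[M]=\{1,\dots,M\}$. For each $A\subseteq[M]$ let $\mathsf P_A$ (expectation $\mathsf E_A$) be a probability measure under which the random elements $X_i(n)$, $i\in[M]$, $n\ge 1$, of a measurable space $\mathbb S$ are independent, each $X_i(n)$ having density $f_{1i}$ if $i\in A$ and $f_{0i}$ if $i\notin A$ with respect to a $\sigma$-finite measure $\nu_i$, and the randomization variables $Z_i(n)$, $i\in[M]$, $n\ge 0$, are independent, uniform on $(0,1)$, and independent of all the $X_i(n)$. Write $Z(n)=(Z_1(n),\dots,Z_M(n))$. Assume that $$I_i=\int\log\frac{f_{1i}}{f_{0i}}\,f_{1i}\,d\nu_i\in(0,\infty),\qquad J_i=\int\log\frac{f_{0i}}{f_{1i}}\,f_{0i}\,d\nu_i\in(0,\infty)\qquad\text{for all } i\in[M].$$ A *policy* $(R,T,\Delta)$ consists of random sets $R(n)\subseteq[M]$, $n\ge1$ (the sources sampled at time $n$), a random time $T\in\{1,2,\dots\}\cup\{\infty\}$ and a random set $\Delta\subseteq[M]$ (the sources declared anomalous upon stopping) such that, with $\mathcal F_0=\sigma(Z(0))$ and $\mathcal F_n=\sigma(\mathcal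 F_{n-1},Z(n),\{X_i(n): i\in R(n)\})$, for all $n\ge1$ and $D\subseteq[M]$, $R(n)$ is $\mathcal F_{n-1}$-measurable, $\{T=n\}\in\mathcal F_n$ and $\{T=n,\Delta=D\}\in\mathcal F_n$. For $k\in[M]$, $K\in(0,M]$ and $\alpha\in(0,1)$, let $\mathcal C(\alpha;k,K)$ be the class of policies with $$\frac1T\sum_{n=1}^T|R(n)|\le K \ \text{ on } \{T<\infty\},\ \mathsf P_A\text{-a.s.},\qquad \mathsf P_A\big(T<\infty,\ |A\triangle\Delta|\ge k\big)\le\alpha,\qquad\text{for all }A\subseteq[M],$$ and let $\mathcal J_A(\alpha;k,K)=\inf_{(R,T,\Delta)\in\mathcal C(\alpha;k,K)}\mathsf E_A[T]\in[1,\infty]$. Let $F_1(A)\le\dots\le F_M(A)$ be the numbers $I_i$ ($i\in A$) and $J_j$ ($j\notin A$) in increasing order, and let $$V(k,K,\boldsymbol F(A))=\max_{c\in[0,1]^M,\ \sum_i c_i\le K}\ \min_{U\subseteq[M],\ |U|=k}\ \sum_{i\in U}c_i\,F_i(A).$$ **Theorem.** Let $g_i=\log(f_{1i}/f_{0i})$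 and suppose that $$\sum_{i=1}^M\int|g_i|\log^+(|g_i|)\,f_{1i}\,d\nu_i<\infty,\qquad \sum_{i=1}^M\int|g_i|\log^+(|g_i|)\,f_{0i}\,d\nu_i<\infty.$$ Then for every $A\subseteq[M]$, $k\in[M]$ and $K\in(0,M]$, $$\liminf_{\alpha\to0^+}\ \frac{\mathcal J_A(\alpha;k,K)}{|\log\alpha|\,/\,V(k,K,\boldsymbol F(A))}\ \ge\ 1 .$$ -/

import Mathlib

open MeasureTheory ProbabilityTheory Filter Topology
open scoped ENNReal NNReal

namespace AnomalyId

/-- `M` independent data sources with values in `S`, observed on a common measurable space `Ω`.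
`P A` is the underlying probability measure when `A` is the set of anomalous sources.
`X i n` is the observation that source `i` generates at time `n + 1` (`n = 0, 1, 2, …`), and
`Z i n`, `n = 0, 1, 2, …`, are the uniform variables used for randomization at time `n`. -/
structure Model (M : ℕ) (S Ω : Type*) [MeasurableSpace S] [MeasurableSpace Ω] where
  /-- the dominating measures -/
  ν : Fin M → Measure S
  sigmaFinite_ν : ∀ i, SigmaFinite (ν i)
  /-- density of a non-anomalous source -/
  f₀ : Fin M → S → ℝ≥0
  /-- density of an anomalous source -/
  f₁ : Fin M → S → ℝ≥0
  measurable_f₀ : ∀ i, Measurable (f₀ i)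
  measurable_f₁ : ∀ i, Measurable (f₁ i)
  P : Finset (Fin M) → Measure Ω
  isProbabilityMeasure_P : ∀ A, IsProbabilityMeasure (P A)
  X : Fin M → ℕ → Ω → S
  Z : Fin M → ℕ → Ω → ℝ
  measurable_X : ∀ i n, Measurable (X i n)
  measurable_Z : ∀ i n, Measurable (Z i n)
  law_X : ∀ A i n, (P A).map (X i n) =
    (ν i).withDensity (fun x => if i ∈ A then (f₁ i x : ℝ≥0∞) else (f₀ i x : ℝ≥0∞))
  law_Z : ∀ A i n, (P A).map (Z i n) = (volume : Measure ℝ).restrict (Set.Ioo 0 1)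
  indep_X : ∀ A, iIndepFun (fun p : Fin M × ℕ => X p.1 p.2) (P A)
  indep_Z : ∀ A, iIndepFun (fun p : Fin M × ℕ => Z p.1 p.2) (P A)
  indep_XZ : ∀ A, IndepFun (fun ω (p : Fin M × ℕ) => X p.1 p.2 ω)
    (fun ω (p : Fin M × ℕ) => Z p.1 p.2 ω) (P A)

namespace Model

variable {M : ℕ} {S Ω : Type*} [MeasurableSpace S] [MeasurableSpace Ω] (m : Model M S Ω)

/-- The distribution of an observation of source `i` when it is not anomalous. -/
noncomputable def law₀ (i : Fin M) : Measure S := (m.ν i).withDensity (fun x => (m.f₀ i x : ℝ≥0∞))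

/-- The distribution of an observation of source `i` when it is anomalous. -/
noncomputable def law₁ (i : Fin M) : Measure S := (m.ν i).withDensity (fun x => (m.f₁ i x : ℝ≥0∞))

/-- The Kullback-Leibler divergence `I_i = ∫ log (f₁ᵢ / f₀ᵢ) f₁ᵢ dνᵢ`, with values in `[0, ∞]`. -/
noncomputable def klI (i : Fin M) : ℝ≥0∞ := InformationTheory.klDiv (m.law₁ i) (m.law₀ i)

/-- The Kullback-Leibler divergence `J_i = ∫ log (f₀ᵢ / f₁ᵢ) f₀ᵢ dνᵢ`, with values in `[0, ∞]`. -/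
noncomputable def klJ (i : Fin M) : ℝ≥0∞ := InformationTheory.klDiv (m.law₀ i) (m.law₁ i)

/-- All Kullback-Leibler numbers are positive and finite. -/
def KLPosFinite : Prop :=
  ∀ i, (0 < m.klI i ∧ m.klI i < ∞) ∧ (0 < m.klJ i ∧ m.klJ i < ∞)

/-- The log-likelihood ratio `g_i = log (f₁ᵢ / f₀ᵢ)` of one observation of source `i`. -/
noncomputable def g (i : Fin M) (x : S) : ℝ := Real.log ((m.f₁ i x : ℝ) / (m.f₀ i x : ℝ))

/-- The `L log L` moment condition on the log-likelihood ratios. -/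
def LLogLMoment : Prop :=
  (∑ i, ∫⁻ x, ENNReal.ofReal (|m.g i x| * Real.posLog |m.g i x|) * (m.f₁ i x : ℝ≥0∞) ∂(m.ν i) < ∞) ∧
  (∑ i, ∫⁻ x, ENNReal.ofReal (|m.g i x| * Real.posLog |m.g i x|) * (m.f₀ i x : ℝ≥0∞) ∂(m.ν i) < ∞)

/-- The information available at time `n` when the sources in `R m ω` are sampled at time `m + 1`:
`F_0 = σ(Z(0))` and `F_{n+1} = σ(F_n, Z(n+1), X_i(n+1) for the sources i sampled at time n+1)`.
An observation is available only on the event that its source is sampled. -/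
@[reducible] def info (R : ℕ → Ω → Finset (Fin M)) : ℕ → MeasurableSpace Ω
  | 0 => ⨆ i, MeasurableSpace.comap (m.Z i 0) inferInstance
  | n + 1 => info R n ⊔ (⨆ i, MeasurableSpace.comap (m.Z i (n + 1)) inferInstance) ⊔
      MeasurableSpace.generateFrom
        {E | ∃ (i : Fin M) (B : Set S), MeasurableSet B ∧ E = {ω | i ∈ R n ω ∧ X m i n ω ∈ B}}

/-- A policy: a sampling rule `R` (`R n` is the set of sources sampled at time `n + 1`, chosen on
the basis of the information at time `n`), a stopping rule `T` with values in `{1, 2, …, ∞}` and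
a decision rule `Δ`, the set of sources declared anomalous upon stopping.  The value of `Δ` is
irrelevant on the event that sampling never stops. -/
structure Policy where
  R : ℕ → Ω → Finset (Fin M)
  T : Ω → ℕ∞
  Δ : Ω → Finset (Fin M)
  sampling_rule : ∀ n D, MeasurableSet[m.info R n] {ω | R n ω = D}
  one_le_T : ∀ ω, 1 ≤ T ω
  stopping_rule : ∀ n : ℕ, MeasurableSet[m.info R n] {ω | T ω = n}
  decision_rule : ∀ (n : ℕ) (D : Finset (Fin M)), MeasurableSet[m.info R n] {ω | T ω = n ∧ Δ ω = D}

/-- The sampling constraint: the average number of observations, from all sources, until stopping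
is at most `K` (almost surely, whatever the set of anomalous sources). -/
def Policy.SamplingConstraint {m : Model M S Ω} (p : m.Policy) (K : ℝ) : Prop :=
  ∀ A, ∀ᵐ ω ∂(m.P A), ∀ t : ℕ, p.T ω = t →
    (∑ n ∈ Finset.range t, ((p.R n ω).card : ℝ)) / t ≤ K

/-- The generalized misclassification error constraint: whatever the set of anomalous sources,
the probability of stopping with at least `k` errors of any kind is at most `α`. -/
def Policy.ErrorConstraint {m : Model M S Ω} (p : m.Policy) (α : ℝ) (k : ℕ) : Prop :=
  ∀ A, m.P A {ω | p.T ω ≠ ⊤ ∧ k ≤ (symmDiff A (p.Δ ω)).card} ≤ ENNReal.ofReal α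

/-- The class of policies that satisfy both constraints. -/
def admissible (α : ℝ) (k : ℕ) (K : ℝ) : Set m.Policy :=
  {p | p.SamplingConstraint K ∧ p.ErrorConstraint α k}

/-- The smallest expected time for stopping among the admissible policies, when `A` is the set of
anomalous sources. -/
noncomputable def optimalTime (A : Finset (Fin M)) (α : ℝ) (k : ℕ) (K : ℝ) : ℝ≥0∞ :=
  ⨅ p ∈ m.admissible α k K, ∫⁻ ω, ((p.T ω : ℕ∞) : ℝ≥0∞) ∂(m.P A)

/-- The Kullback-Leibler number of source `i`: `I_i` if `i ∈ A`, and `J_i` otherwise. -/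
noncomputable def klNumber (A : Finset (Fin M)) (i : Fin M) : ℝ :=
  if i ∈ A then (m.klI i).toReal else (m.klJ i).toReal

/-- The ordered set `F(A)`: the numbers `I_i`, `i ∈ A`, and `J_j`, `j ∉ A`, in increasing order. -/
noncomputable def orderedKL (A : Finset (Fin M)) : Fin M → ℝ :=
  m.klNumber A ∘ Tuple.sort (m.klNumber A)

end Model

/-- The domain `{c ∈ [0,1]^M : ∑ c_i ≤ K}`. -/
def frequencyDomain (M : ℕ) (K : ℝ) : Set (Fin M → ℝ) :=
  {c | (∀ i, c i ∈ Set.Icc (0 : ℝ) 1) ∧ ∑ i, c i ≤ K}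

/-- The minimum of `∑_{i ∈ U} c_i L_i` over all sets `U` of `κ` indices. -/
noncomputable def minInfo {M : ℕ} (c : Fin M → ℝ) (κ : ℕ) (L : Fin M → ℝ) : ℝ :=
  ⨅ U : {U : Finset (Fin M) // U.card = κ}, ∑ i ∈ U.1, c i * L i

/-- The value `V(κ, K, L)` of the max-min problem: the maximum of `minInfo c κ L` over the
frequency domain. -/
noncomputable def maxMinValue {M : ℕ} (κ : ℕ) (K : ℝ) (L : Fin M → ℝ) : ℝ :=
  sSup ((fun c => minInfo c κ L) '' frequencyDomain M K)

end AnomalyId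

/-!
Let a policy stop by time `t`, slightly less than `|log α| / V`. Up to stopping, the log-likelihood
ratio of the observations sampled from source `i` stays close to its compensator, the number of
samples times the Kullback-Leibler number of the source. Hence, by the sampling constraint and the
definition of `V`, some set `W` of `k` sources has produced a total log-likelihood ratio of at most
about `t V < |log α|`. If `D` is the decision, removing from `W` the sources in `A ∆ D` leaves a set
`U` such that `D` has at least `k` errors with respect to `A ∆ U`. A change of measure from `A` to
`A ∆ U` on the sampled information bounds the probability of this event by `exp (t V) α`, which
tends to `0`.

The class of policies varies with `α`, so the law of large numbers has to hold in probability
uniformly over all sampling and stopping rules. Splitting the increments into a bounded centred part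
and a remainder that is small in `L¹` gives this from integrability alone.
-/

namespace AnomalyId

section ChangeOfMeasure

variable {Ω S : Type*} [MeasurableSpace S] {𝓖 𝓕 mΩ : MeasurableSpace Ω} {μ ν : Measure Ω}
  {G : Set Ω} {Y : Ω → S}

/-- The σ-algebra generated by a random element `Y` that is observed only on the event `G`.  The
event `G` itself belongs to it. -/
@[reducible] def observedOn (G : Set Ω) (Y : Ω → S) : MeasurableSpace Ω :=
  MeasurableSpace.generateFrom {E | ∃ B : Set S, MeasurableSet B ∧ E = G ∩ Y ⁻¹' B}

theorem measurableSet_observedOn_inter_preimage {B : Set S} (hB : MeasurableSet B) :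
    MeasurableSet[observedOn G Y] (G ∩ Y ⁻¹' B) :=
  MeasurableSpace.measurableSet_generateFrom ⟨B, hB, rfl⟩

theorem observedOn_le (hG : MeasurableSet[𝓕] G) (hY : Measurable[𝓕] Y) : observedOn G Y ≤ 𝓕 := by
  refine MeasurableSpace.generateFrom_le ?_
  rintro _ ⟨B, hB, rfl⟩
  exact hG.inter (hY hB)

theorem observedOn_univ (Y : Ω → S) :
    observedOn Set.univ Y = MeasurableSpace.comap Y inferInstance :=
  le_antisymm (observedOn_le MeasurableSet.univ (comap_measurable Y)) fun _ ⟨B, hB, hE⟩ => by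
    simpa only [← hE, Set.univ_inter] using
      measurableSet_observedOn_inter_preimage (G := Set.univ) (Y := Y) hB

theorem measurable_mulIndicator_observedOn {r : S → ℝ≥0∞} (hr : Measurable r) :
    Measurable[observedOn G Y] (G.mulIndicator (r ∘ Y)) := by
  classical
  have hG : MeasurableSet[observedOn G Y] G := by
    simpa using measurableSet_observedOn_inter_preimage (G := G) (Y := Y) MeasurableSet.univ
  intro C hC
  rw [Set.mulIndicator_preimage, Set.ite, Set.inter_comm, Set.preimage_comp]
  refine (measurableSet_observedOn_inter_preimage (hr hC)).union (MeasurableSet.diff ?_ hG)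
  exact (measurable_const : Measurable[observedOn G Y] (1 : Ω → ℝ≥0∞)) hC

theorem sup_observedOn_eq_generateFrom (hG : MeasurableSet[𝓕] G) :
    𝓕 ⊔ observedOn G Y = MeasurableSpace.generateFrom
      {E | ∃ s B, MeasurableSet[𝓕] s ∧ MeasurableSet B ∧ E = s ∩ (Gᶜ ∪ Y ⁻¹' B)} := by
  apply le_antisymm
  · refine sup_le (fun s hs => ?_) (MeasurableSpace.generateFrom_mono ?_)
    · exact MeasurableSpace.measurableSet_generateFrom
        ⟨s, Set.univ, hs, MeasurableSet.univ, by simp⟩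
    · rintro _ ⟨B, hB, rfl⟩
      exact ⟨G, B, hG, hB, by simp [Set.inter_union_distrib_left]⟩
  · refine MeasurableSpace.generateFrom_le ?_
    rintro _ ⟨s, B, hs, hB, rfl⟩
    have hsplit : s ∩ (Gᶜ ∪ Y ⁻¹' B) = s ∩ (Gᶜ ∪ G ∩ Y ⁻¹' B) := by
      rw [Set.union_inter_distrib_left, Set.compl_union_self, Set.univ_inter]
    have hF : 𝓕 ≤ 𝓕 ⊔ observedOn G Y := le_sup_left
    have hO : observedOn G Y ≤ 𝓕 ⊔ observedOn G Y := le_sup_right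
    rw [hsplit]
    exact (hF _ hs).inter
      ((hF _ hG.compl).union (hO _ (measurableSet_observedOn_inter_preimage hB)))

theorem measure_eq_of_measurableSet_sup_observedOn (h𝓕 : 𝓕 ≤ mΩ) (hY : Measurable Y)
    (hG : MeasurableSet[𝓕] G) [IsFiniteMeasure μ]
    (h : ∀ s B, MeasurableSet[𝓕] s → MeasurableSet B →
      μ (s ∩ (Gᶜ ∪ Y ⁻¹' B)) = ν (s ∩ (Gᶜ ∪ Y ⁻¹' B)))
    {E : Set Ω} (hE : MeasurableSet[𝓕 ⊔ observedOn G Y] E) : μ E = ν E := by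
  have hle : 𝓕 ⊔ observedOn G Y ≤ mΩ := sup_le h𝓕 (observedOn_le (h𝓕 _ hG) hY)
  have hgen := sup_observedOn_eq_generateFrom (Y := Y) hG
  have htrim : μ.trim hle = ν.trim hle := by
    refine ext_of_generate_finite _ hgen ?_ ?_ ?_
    · rintro _ ⟨s, B, hs, hB, rfl⟩ _ ⟨s', B', hs', hB', rfl⟩ -
      exact ⟨s ∩ s', B ∩ B', hs.inter hs', hB.inter hB', by
        rw [Set.inter_inter_inter_comm, Set.preimage_inter, Set.union_inter_distrib_left]⟩
    · rintro _ ⟨s, B, hs, hB, rfl⟩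
      have hm : MeasurableSet[𝓕 ⊔ observedOn G Y] (s ∩ (Gᶜ ∪ Y ⁻¹' B)) := by
        rw [hgen]
        exact MeasurableSpace.measurableSet_generateFrom ⟨s, B, hs, hB, rfl⟩
      rw [trim_measurableSet_eq hle hm, trim_measurableSet_eq hle hm, h s B hs hB]
    · rw [trim_measurableSet_eq hle MeasurableSet.univ,
        trim_measurableSet_eq hle MeasurableSet.univ]
      simpa using h Set.univ Set.univ MeasurableSet.univ MeasurableSet.univ
  rw [← trim_measurableSet_eq hle hE, htrim, trim_measurableSet_eq hle hE]

theorem indep_sup_comap (h𝓕 : 𝓕 ≤ mΩ) (hY : Measurable Y)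
    [IsFiniteMeasure μ] (h : Indep 𝓖 𝓕 μ)
    (h' : Indep (𝓖 ⊔ 𝓕) (MeasurableSpace.comap Y inferInstance) μ) :
    Indep 𝓖 (𝓕 ⊔ MeasurableSpace.comap Y inferInstance) μ := by
  rw [← observedOn_univ]
  rw [Indep_iff] at h h' ⊢
  intro s E hs hE
  have hle : 𝓕 ⊔ observedOn Set.univ Y ≤ mΩ := sup_le h𝓕 (observedOn_le MeasurableSet.univ hY)
  suffices μ.restrict s E = (μ s • μ) E by
    rwa [Measure.restrict_apply (hle E hE), Set.inter_comm] at this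
  refine measure_eq_of_measurableSet_sup_observedOn h𝓕 hY MeasurableSet.univ
    (fun a B ha hB => ?_) hE
  have hs' : MeasurableSet[𝓖 ⊔ 𝓕] s := (le_sup_left : 𝓖 ≤ 𝓖 ⊔ 𝓕) s hs
  have ha' : MeasurableSet[𝓖 ⊔ 𝓕] a := (le_sup_right : 𝓕 ≤ 𝓖 ⊔ 𝓕) a ha
  rw [Set.compl_univ, Set.empty_union, Measure.restrict_apply ((h𝓕 a ha).inter (hY hB)),
    Set.inter_comm, ← Set.inter_assoc, h' _ _ (hs'.inter ha') ⟨B, hB, rfl⟩, h _ _ hs ha,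
    Measure.smul_apply, h' _ _ ha' ⟨B, hB, rfl⟩, smul_eq_mul, mul_assoc]

/-- `L` is the likelihood ratio of `ν` against `μ` for the information `𝓕`: the restriction of `ν`
to the σ-algebra `𝓕` has density `L` with respect to the restriction of `μ`. -/
structure IsLikelihoodRatioOn (𝓕 : MeasurableSpace Ω) {mΩ : MeasurableSpace Ω} (ν μ : Measure Ω)
    (L : Ω → ℝ≥0∞) : Prop where
  measurable : Measurable[𝓕] L
  measure_eq : ∀ E, MeasurableSet[𝓕] E → ν E = ∫⁻ ω in E, L ω ∂μ

namespace IsLikelihoodRatioOn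

variable {L : Ω → ℝ≥0∞}

theorem measure_inter_le (hL : IsLikelihoodRatioOn 𝓕 ν μ L) {E : Set Ω} (hE : MeasurableSet[𝓕] E)
    (c : ℝ≥0∞) : ν (E ∩ {ω | L ω ≤ c}) ≤ c * μ E := by
  have hm : MeasurableSet[𝓕] (E ∩ {ω | L ω ≤ c}) :=
    hE.inter (hL.measurable measurableSet_Iic)
  calc ν (E ∩ {ω | L ω ≤ c}) = ∫⁻ ω in E ∩ {ω | L ω ≤ c}, L ω ∂μ := hL.measure_eq _ hm
    _ ≤ ∫⁻ _ in E ∩ {ω | L ω ≤ c}, c ∂μ := setLIntegral_mono measurable_const fun _ hω => hω.2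
    _ = c * μ (E ∩ {ω | L ω ≤ c}) := setLIntegral_const _ _
    _ ≤ c * μ E := by gcongr; exact Set.inter_subset_left

theorem measure_inter_preimage (h𝓕 : 𝓕 ≤ mΩ) (hL : IsLikelihoodRatioOn 𝓕 ν μ L) (hY : Measurable Y)
    {r : S → ℝ≥0∞} (hr : Measurable r) (hlaw : ν.map Y = (μ.map Y).withDensity r)
    (hν : Indep 𝓕 (MeasurableSpace.comap Y inferInstance) ν)
    (hμ : Indep 𝓕 (MeasurableSpace.comap Y inferInstance) μ)
    {s : Set Ω} (hs : MeasurableSet[𝓕] s) {B : Set S} (hB : MeasurableSet B) :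
    ν (s ∩ Y ⁻¹' B) = ∫⁻ ω in s ∩ Y ⁻¹' B, L ω * r (Y ω) ∂μ := by
  have hsm : MeasurableSet s := h𝓕 s hs
  have hrY : Measurable[MeasurableSpace.comap Y inferInstance] (r ∘ Y) :=
    hr.comp (comap_measurable Y)
  calc ν (s ∩ Y ⁻¹' B) = ν s * ν (Y ⁻¹' B) := (Indep_iff _ _ _).1 hν _ _ hs ⟨B, hB, rfl⟩
    _ = (∫⁻ ω in s, L ω ∂μ) * ∫⁻ ω in Y ⁻¹' B, r (Y ω) ∂μ := by
        rw [hL.measure_eq s hs, ← Measure.map_apply hY hB, hlaw, withDensity_apply _ hB,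
          setLIntegral_map hB hr hY]
    _ = ∫⁻ ω, s.indicator L ω * (Y ⁻¹' B).indicator (r ∘ Y) ω ∂μ := by
        rw [← lintegral_indicator hsm, ← lintegral_indicator (hY hB)]
        exact (lintegral_mul_eq_lintegral_mul_lintegral_of_independent_measurableSpace h𝓕
          hY.comap_le hμ (hL.measurable.indicator hs) (hrY.indicator ⟨B, hB, rfl⟩)).symm
    _ = ∫⁻ ω in s ∩ Y ⁻¹' B, L ω * r (Y ω) ∂μ := by
        rw [← lintegral_indicator (hsm.inter (hY hB))]
        simp only [Set.inter_indicator_mul]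
        rfl

theorem sup_observedOn [IsFiniteMeasure ν] (h𝓕 : 𝓕 ≤ mΩ) (hL : IsLikelihoodRatioOn 𝓕 ν μ L)
    (hY : Measurable Y) {r : S → ℝ≥0∞} (hr : Measurable r)
    (hlaw : ν.map Y = (μ.map Y).withDensity r)
    (hν : Indep 𝓕 (MeasurableSpace.comap Y inferInstance) ν)
    (hμ : Indep 𝓕 (MeasurableSpace.comap Y inferInstance) μ) (hG : MeasurableSet[𝓕] G) :
    IsLikelihoodRatioOn (𝓕 ⊔ observedOn G Y) ν μ (fun ω => L ω * G.mulIndicator (r ∘ Y) ω) where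
  measurable := (hL.measurable.mono le_sup_left le_rfl).mul
    ((measurable_mulIndicator_observedOn hr).mono le_sup_right le_rfl)
  measure_eq E hE := by
    have hGm : MeasurableSet G := h𝓕 G hG
    have hle : 𝓕 ⊔ observedOn G Y ≤ mΩ := sup_le h𝓕 (observedOn_le hGm hY)
    rw [← withDensity_apply _ (hle E hE)]
    refine measure_eq_of_measurableSet_sup_observedOn h𝓕 hY hG (fun s B hs hB => ?_) hE
    have hsm : MeasurableSet s := h𝓕 s hs
    have hunobserved : MeasurableSet (s ∩ Gᶜ) := hsm.inter hGm.compl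
    have hobserved : MeasurableSet (s ∩ G ∩ Y ⁻¹' B) := (hsm.inter hGm).inter (hY hB)
    have hsplit : s ∩ (Gᶜ ∪ Y ⁻¹' B) = s ∩ Gᶜ ∪ s ∩ G ∩ Y ⁻¹' B := by
      ext ω; by_cases hω : ω ∈ G <;> simp [hω]
    have hdisj : Disjoint (s ∩ Gᶜ) (s ∩ G ∩ Y ⁻¹' B) :=
      Set.disjoint_left.2 fun ω h h' => h.2 h'.1.2
    rw [hsplit, measure_union hdisj hobserved, measure_union hdisj hobserved,
      withDensity_apply _ hunobserved, withDensity_apply _ hobserved,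
      hL.measure_eq _ (hs.inter hG.compl),
      hL.measure_inter_preimage h𝓕 hY hr hlaw hν hμ (hs.inter hG) hB]
    congr 1
    · refine setLIntegral_congr_fun hunobserved fun ω hω => ?_
      simp [Set.mulIndicator_of_notMem hω.2]
    · refine setLIntegral_congr_fun hobserved fun ω hω => ?_
      simp [Set.mulIndicator_of_mem hω.1.2]

theorem sup_biSup_observedOn {ι : Type*} [IsFiniteMeasure ν] (hL : IsLikelihoodRatioOn 𝓕 ν μ L)
    {Y : ι → Ω → S} (hY : ∀ i, Measurable (Y i)) {r : ι → S → ℝ≥0∞} (hr : ∀ i, Measurable (r i))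
    (hlaw : ∀ i, ν.map (Y i) = (μ.map (Y i)).withDensity (r i))
    {G : ι → Set Ω} (hG : ∀ i, MeasurableSet[𝓕] (G i)) (h𝓕 : 𝓕 ≤ mΩ)
    (hν : ∀ (s : Finset ι), ∀ i ∉ s, Indep (𝓕 ⊔ ⨆ j ∈ s, observedOn (G j) (Y j))
      (MeasurableSpace.comap (Y i) inferInstance) ν)
    (hμ : ∀ (s : Finset ι), ∀ i ∉ s, Indep (𝓕 ⊔ ⨆ j ∈ s, observedOn (G j) (Y j))
      (MeasurableSpace.comap (Y i) inferInstance) μ) (s : Finset ι) :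
    IsLikelihoodRatioOn (𝓕 ⊔ ⨆ i ∈ s, observedOn (G i) (Y i)) ν μ
      (fun ω => L ω * ∏ i ∈ s, (G i).mulIndicator (r i ∘ Y i) ω) := by
  classical
  induction s using Finset.induction_on with
  | empty => simpa using hL
  | insert i s hi ih =>
    have hle : 𝓕 ⊔ ⨆ j ∈ s, observedOn (G j) (Y j) ≤ mΩ :=
      sup_le h𝓕 (iSup₂_le fun j _ => observedOn_le (h𝓕 _ (hG j)) (hY j))
    have hGi : MeasurableSet[𝓕 ⊔ ⨆ j ∈ s, observedOn (G j) (Y j)] (G i) :=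
      (le_sup_left : 𝓕 ≤ _) _ (hG i)
    have hstep := ih.sup_observedOn hle (hY i) (hr i) (hlaw i) (hν s i hi) (hμ s i hi) hGi
    rw [Finset.iSup_insert, sup_comm (observedOn (G i) (Y i)), ← sup_assoc]
    simpa only [Finset.prod_insert hi, mul_comm, mul_left_comm] using hstep

end IsLikelihoodRatioOn

end ChangeOfMeasure

section UniformWeakLaw

variable {Ω : Type*} {mΩ : MeasurableSpace Ω} {μ : Measure Ω} {𝓖 : Filtration ℕ mΩ}
  {w ξ : ℕ → Ω → ℝ}

theorem sq_integral_abs_le [IsProbabilityMeasure μ] {f : Ω → ℝ} (hf : MemLp f 2 μ) :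
    (∫ ω, |f ω| ∂μ) ^ 2 ≤ ∫ ω, f ω ^ 2 ∂μ := by
  have h := variance_nonneg (fun ω => ‖f ω‖) μ
  rw [variance_eq_sub hf.norm, sub_nonneg] at h
  simpa using h

/-- `w` is a sequence of predictable weights: the weight `w n` of the increment `ξ n` that is
revealed between times `n` and `n + 1` is known at time `n`, and its absolute value is at most
one. -/
structure IsPredictableWeight (𝓖 : Filtration ℕ mΩ) (w : ℕ → Ω → ℝ) : Prop where
  measurable : ∀ n, Measurable[𝓖 n] (w n)
  abs_le_one : ∀ n ω, |w n ω| ≤ 1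

namespace IsPredictableWeight

theorem memLp_mul (hw : IsPredictableWeight 𝓖 w) {p : ℝ≥0∞} {n : ℕ} (hξ : MemLp (ξ n) p μ) :
    MemLp (fun ω => w n ω * ξ n ω) p μ := by
  have hwm : Measurable (w n) := (hw.measurable n).mono (𝓖.le n) le_rfl
  refine hξ.of_le (hwm.aestronglyMeasurable.mul hξ.1) (ae_of_all _ fun ω => ?_)
  rw [norm_mul]
  exact mul_le_of_le_one_left (norm_nonneg _) (hw.abs_le_one n ω)

theorem memLp_sum (hw : IsPredictableWeight 𝓖 w) {p : ℝ≥0∞} (hξ : ∀ n, MemLp (ξ n) p μ) (t : ℕ) :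
    MemLp (fun ω => ∑ s ∈ Finset.range t, w s ω * ξ s ω) p μ :=
  memLp_finsetSum _ fun s _ => hw.memLp_mul (hξ s)

theorem measurable_sum (hw : IsPredictableWeight 𝓖 w)
    (hξm : ∀ n, Measurable[𝓖 (n + 1)] (ξ n)) (t : ℕ) :
    Measurable[𝓖 t] fun ω => ∑ s ∈ Finset.range t, w s ω * ξ s ω := by
  refine Finset.measurable_sum _ fun s hs => ?_
  have hst : s < t := Finset.mem_range.1 hs
  exact ((hw.measurable s).mono (𝓖.mono hst.le) le_rfl).mul ((hξm s).mono (𝓖.mono hst) le_rfl)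

/-- The increments of the sum are orthogonal. -/
theorem integral_sum_sq_le (hw : IsPredictableWeight 𝓖 w)
    (hξm : ∀ n, Measurable[𝓖 (n + 1)] (ξ n))
    (hindep : ∀ n, Indep (𝓖 n) (MeasurableSpace.comap (ξ n) inferInstance) μ)
    (hξ : ∀ n, MemLp (ξ n) 2 μ) (hmean : ∀ n, ∫ ω, ξ n ω ∂μ = 0) (t : ℕ) :
    ∫ ω, (∑ s ∈ Finset.range t, w s ω * ξ s ω) ^ 2 ∂μ ≤
      ∑ s ∈ Finset.range t, ∫ ω, ξ s ω ^ 2 ∂μ := by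
  induction t with
  | zero => simp
  | succ t ih =>
    set Y : Ω → ℝ := fun ω => ∑ s ∈ Finset.range t, w s ω * ξ s ω
    have hY : MemLp Y 2 μ := hw.memLp_sum hξ t
    have hYw : Measurable[𝓖 t] (fun ω => w t ω * Y ω) :=
      (hw.measurable t).mul (hw.measurable_sum hξm t)
    have hYwL : MemLp (fun ω => w t ω * Y ω) 2 μ := hw.memLp_mul (ξ := fun _ => Y) hY
    have hcross_int : Integrable (fun ω => w t ω * Y ω * ξ t ω) μ := hYwL.integrable_mul (hξ t)
    have hcross : ∫ ω, w t ω * Y ω * ξ t ω ∂μ = 0 := by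
      have hYξ : IndepFun (fun ω => w t ω * Y ω) (ξ t) μ :=
        indep_of_indep_of_le_left (hindep t) hYw.comap_le
      rw [hYξ.integral_fun_mul_eq_mul_integral hYwL.1 (hξ t).1, hmean, mul_zero]
    have hwξ := hw.memLp_mul (hξ t)
    have hsq : ∫ ω, (w t ω * ξ t ω) ^ 2 ∂μ ≤ ∫ ω, ξ t ω ^ 2 ∂μ := by
      refine integral_mono hwξ.integrable_sq (hξ t).integrable_sq fun ω => ?_
      simp only [mul_pow]
      exact mul_le_of_le_one_left (sq_nonneg _) ((sq_le_one_iff_abs_le_one _).2 (hw.abs_le_one t ω))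
    calc ∫ ω, (∑ s ∈ Finset.range (t + 1), w s ω * ξ s ω) ^ 2 ∂μ
        = ∫ ω, (Y ω ^ 2 + 2 * (w t ω * Y ω * ξ t ω) + (w t ω * ξ t ω) ^ 2) ∂μ := by
          refine integral_congr_ae (ae_of_all _ fun ω => ?_)
          simp only [Finset.sum_range_succ, Y]
          ring
      _ = ∫ ω, Y ω ^ 2 ∂μ + ∫ ω, (w t ω * ξ t ω) ^ 2 ∂μ := by
          rw [integral_add (hY.integrable_sq.fun_add (hcross_int.const_mul 2)) hwξ.integrable_sq,
            integral_add hY.integrable_sq (hcross_int.const_mul 2), integral_const_mul, hcross,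
            mul_zero, add_zero]
      _ ≤ ∑ s ∈ Finset.range (t + 1), ∫ ω, ξ s ω ^ 2 ∂μ := by
          rw [Finset.sum_range_succ]
          exact add_le_add ih hsq

theorem integral_abs_sum_le_sqrt [IsProbabilityMeasure μ] (hw : IsPredictableWeight 𝓖 w)
    (hξm : ∀ n, Measurable[𝓖 (n + 1)] (ξ n))
    (hindep : ∀ n, Indep (𝓖 n) (MeasurableSpace.comap (ξ n) inferInstance) μ)
    (hident : ∀ n, IdentDistrib (ξ n) (ξ 0) μ μ) (hξ : MemLp (ξ 0) 2 μ)
    (hmean : ∫ ω, ξ 0 ω ∂μ = 0) (t : ℕ) :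
    ∫ ω, |∑ s ∈ Finset.range t, w s ω * ξ s ω| ∂μ ≤ √(t * ∫ ω, ξ 0 ω ^ 2 ∂μ) := by
  have hξL (n : ℕ) : MemLp (ξ n) 2 μ := (hident n).memLp_iff.2 hξ
  have hξ0 (n : ℕ) : ∫ ω, ξ n ω ∂μ = 0 := (hident n).integral_eq.trans hmean
  have hsq (n : ℕ) : ∫ ω, ξ n ω ^ 2 ∂μ = ∫ ω, ξ 0 ω ^ 2 ∂μ :=
    ((hident n).comp (measurable_id.pow_const 2)).integral_eq
  refine Real.le_sqrt_of_sq_le ((sq_integral_abs_le (hw.memLp_sum hξL t)).trans ?_)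
  simpa only [hsq, Finset.sum_const, Finset.card_range, nsmul_eq_mul] using
    hw.integral_sum_sq_le hξm hindep hξL hξ0 t

theorem integral_abs_sum_le_add (hw : IsPredictableWeight 𝓖 w) {η : ℕ → Ω → ℝ}
    (hξ : ∀ n, Integrable (ξ n) μ) (hη : ∀ n, Integrable (η n) μ) (t : ℕ) :
    ∫ ω, |∑ s ∈ Finset.range t, w s ω * ξ s ω| ∂μ ≤
      ∫ ω, |∑ s ∈ Finset.range t, w s ω * η s ω| ∂μ +
        ∑ s ∈ Finset.range t, ∫ ω, |ξ s ω - η s ω| ∂μ := by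
  have hdiff (s : ℕ) : Integrable (fun ω => |ξ s ω - η s ω|) μ := ((hξ s).sub (hη s)).abs
  have hsum : Integrable (fun ω => |∑ s ∈ Finset.range t, w s ω * η s ω|) μ :=
    (memLp_one_iff_integrable.1
      (hw.memLp_sum (fun n => memLp_one_iff_integrable.2 (hη n)) t)).abs
  have hrest : Integrable (fun ω => ∑ s ∈ Finset.range t, |ξ s ω - η s ω|) μ :=
    integrable_finsetSum _ fun s _ => hdiff s
  rw [← integral_finsetSum _ fun s _ => hdiff s, ← integral_add hsum hrest]
  refine integral_mono_of_nonneg (ae_of_all _ fun _ => abs_nonneg _) (hsum.add hrest)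
    (ae_of_all _ fun ω => ?_)
  calc |∑ s ∈ Finset.range t, w s ω * ξ s ω|
      = |∑ s ∈ Finset.range t, w s ω * η s ω +
          ∑ s ∈ Finset.range t, w s ω * (ξ s ω - η s ω)| := by
        rw [← Finset.sum_add_distrib]
        simp only [← mul_add, add_sub_cancel]
    _ ≤ |∑ s ∈ Finset.range t, w s ω * η s ω| +
          ∑ s ∈ Finset.range t, |w s ω * (ξ s ω - η s ω)| :=
        (abs_add_le _ _).trans (add_le_add_right (Finset.abs_sum_le_sum_abs _ _) _)
    _ ≤ |∑ s ∈ Finset.range t, w s ω * η s ω| + ∑ s ∈ Finset.range t, |ξ s ω - η s ω| := by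
        refine add_le_add_right (Finset.sum_le_sum fun s _ => ?_) _
        rw [abs_mul]
        exact mul_le_of_le_one_left (abs_nonneg _) (hw.abs_le_one s ω)

end IsPredictableWeight

theorem exists_simpleFunc_integral_eq_zero {S : Type*} [MeasurableSpace S] {μ : Measure S}
    [IsProbabilityMeasure μ] {f : S → ℝ} (hf : Integrable f μ) (hmean : ∫ x, f x ∂μ = 0) {ε : ℝ}
    (hε : 0 < ε) : ∃ h : SimpleFunc S ℝ, ∫ x, h x ∂μ = 0 ∧ ∫ x, |f x - h x| ∂μ ≤ ε := by
  obtain ⟨g, hgf, hg⟩ := (memLp_one_iff_integrable.2 hf).exists_simpleFunc_eLpNorm_sub_lt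
    ENNReal.one_ne_top (ENNReal.ofReal_pos.2 (half_pos hε)).ne'
  rw [memLp_one_iff_integrable] at hg
  have hdist : ∫ x, |f x - g x| ∂μ ≤ ε / 2 := by
    have hnorm := ofReal_integral_norm_eq_lintegral_enorm (hf.sub hg)
    rw [← eLpNorm_one_eq_lintegral_enorm] at hnorm
    rw [← ENNReal.ofReal_le_ofReal_iff (half_pos hε).le]
    exact hnorm.le.trans hgf.le
  set c := ∫ x, g x ∂μ
  have hc : |c| ≤ ε / 2 := by
    have hcf : c = -∫ x, (f x - g x) ∂μ := by rw [integral_sub hf hg, hmean, zero_sub, neg_neg]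
    rw [hcf, abs_neg]
    exact (abs_integral_le_integral_abs).trans hdist
  refine ⟨g - SimpleFunc.const S c, ?_, ?_⟩
  · simp only [SimpleFunc.coe_sub, SimpleFunc.coe_const, Pi.sub_apply, Function.const_apply]
    rw [integral_sub hg (integrable_const c)]
    simp [c]
  · have hfg : Integrable (fun x => |f x - g x|) μ := (hf.sub hg).abs
    calc ∫ x, |f x - (g - SimpleFunc.const S c) x| ∂μ ≤ ∫ x, (|f x - g x| + |c|) ∂μ := by
          refine integral_mono (hf.sub (hg.sub (integrable_const c))).abs
            (hfg.add (integrable_const _)) fun x => ?_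
          simp only [SimpleFunc.coe_sub, SimpleFunc.coe_const, Pi.sub_apply, Function.const_apply,
            sub_sub_eq_add_sub, add_sub_right_comm]
          exact abs_add_le _ _
      _ = ∫ x, |f x - g x| ∂μ + |c| := by
          rw [integral_add hfg (integrable_const _)]
          simp
      _ ≤ ε := by linarith

theorem exists_measurable_memLp_two_comp [IsProbabilityMeasure μ] {f : Ω → ℝ}
    (hf : Integrable f μ) (hmean : ∫ ω, f ω ∂μ = 0) {ε : ℝ} (hε : 0 < ε) :
    ∃ h : ℝ → ℝ, Measurable h ∧ MemLp (h ∘ f) 2 μ ∧ ∫ ω, h (f ω) ∂μ = 0 ∧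
      ∫ ω, |f ω - h (f ω)| ∂μ ≤ ε := by
  have hfm : AEMeasurable f μ := hf.aemeasurable
  have := Measure.isProbabilityMeasure_map hfm
  have hid : Integrable (fun x => x) (μ.map f) :=
    (integrable_map_measure aestronglyMeasurable_id hfm).2 hf
  obtain ⟨h, hh0, hhε⟩ := exists_simpleFunc_integral_eq_zero hid
    ((integral_map hfm aestronglyMeasurable_id).trans hmean) hε
  have hrest : Measurable fun x => |x - h x| := (measurable_id.sub h.measurable).abs
  rw [integral_map hfm h.measurable.aestronglyMeasurable] at hh0
  rw [integral_map hfm hrest.aestronglyMeasurable] at hhε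
  exact ⟨h, h.measurable, (h.memLp_of_isFiniteMeasure 2 _).comp_of_map hfm, hh0, hhε⟩

/-- The square-integrable part of the increments contributes `O(√t)`, and the remainder is small in
`L¹`. -/
theorem exists_integral_abs_predictable_sum_le [IsProbabilityMeasure μ]
    (hξm : ∀ n, Measurable[𝓖 (n + 1)] (ξ n))
    (hindep : ∀ n, Indep (𝓖 n) (MeasurableSpace.comap (ξ n) inferInstance) μ)
    (hident : ∀ n, IdentDistrib (ξ n) (ξ 0) μ μ) (hξ : Integrable (ξ 0) μ)
    (hmean : ∫ ω, ξ 0 ω ∂μ = 0) {ε : ℝ} (hε : 0 < ε) :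
    ∃ t₀ : ℕ, ∀ t ≥ t₀, ∀ w, IsPredictableWeight 𝓖 w →
      ∫ ω, |∑ s ∈ Finset.range t, w s ω * ξ s ω| ∂μ ≤ ε * t := by
  obtain ⟨h, hhm, hhL, hh0, hhε⟩ := exists_measurable_memLp_two_comp hξ hmean (half_pos hε)
  have hhξ (n : ℕ) : MemLp (fun ω => h (ξ n ω)) 2 μ := ((hident n).comp hhm).memLp_iff.2 hhL
  have hrest : Measurable fun x => |x - h x| := (measurable_id.sub hhm).abs
  have hrestε (s : ℕ) : ∫ ω, |ξ s ω - h (ξ s ω)| ∂μ ≤ ε / 2 :=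
    ((hident s).comp hrest).integral_eq.trans_le hhε
  set v : ℝ := ∫ ω, h (ξ 0 ω) ^ 2 ∂μ
  obtain ⟨t₀, ht₀⟩ := exists_nat_ge (v / (ε / 2) ^ 2)
  refine ⟨t₀, fun t ht w hw => ?_⟩
  have hv : v ≤ t * (ε / 2) ^ 2 :=
    (div_le_iff₀ (by positivity)).1 (ht₀.trans (Nat.cast_le.2 ht))
  calc ∫ ω, |∑ s ∈ Finset.range t, w s ω * ξ s ω| ∂μ
      ≤ ∫ ω, |∑ s ∈ Finset.range t, w s ω * h (ξ s ω)| ∂μ +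
          ∑ s ∈ Finset.range t, ∫ ω, |ξ s ω - h (ξ s ω)| ∂μ :=
        hw.integral_abs_sum_le_add (fun n => (hident n).integrable_iff.2 hξ)
          (fun n => (hhξ n).integrable one_le_two) t
    _ ≤ √(t * v) + ∑ s ∈ Finset.range t, ε / 2 := by
        gcongr with s
        · exact hw.integral_abs_sum_le_sqrt (fun n => hhm.comp (hξm n))
            (fun n => indep_of_indep_of_le_right (hindep n)
              (hhm.comp (comap_measurable (ξ n))).comap_le)
            (fun n => (hident n).comp hhm) (hhξ 0) hh0 t
        · exact hrestε s
    _ ≤ t * (ε / 2) + ∑ s ∈ Finset.range t, ε / 2 := by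
        gcongr
        refine Real.sqrt_le_iff.2 ⟨by positivity, ?_⟩
        calc t * v ≤ t * (t * (ε / 2) ^ 2) := by gcongr
          _ = (t * (ε / 2)) ^ 2 := by ring
    _ = ε * t := by
        rw [Finset.sum_const, Finset.card_range, nsmul_eq_mul]
        ring

theorem exists_measureReal_abs_predictable_sum_ge_le [IsProbabilityMeasure μ]
    (hξm : ∀ n, Measurable[𝓖 (n + 1)] (ξ n))
    (hindep : ∀ n, Indep (𝓖 n) (MeasurableSpace.comap (ξ n) inferInstance) μ)
    (hident : ∀ n, IdentDistrib (ξ n) (ξ 0) μ μ) (hξ : Integrable (ξ 0) μ)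
    (hmean : ∫ ω, ξ 0 ω ∂μ = 0) {δ η : ℝ} (hδ : 0 < δ) (hη : 0 < η) :
    ∃ t₀ : ℕ, ∀ t ≥ t₀, ∀ w, IsPredictableWeight 𝓖 w →
      μ.real {ω | δ * t ≤ |∑ s ∈ Finset.range t, w s ω * ξ s ω|} ≤ η := by
  obtain ⟨t₀, ht₀⟩ :=
    exists_integral_abs_predictable_sum_le hξm hindep hident hξ hmean (mul_pos hη hδ)
  refine ⟨max t₀ 1, fun t ht w hw => ?_⟩
  have htpos : (0 : ℝ) < t := Nat.cast_pos.2 (le_of_max_le_right ht)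
  have hsum := memLp_one_iff_integrable.1
    (hw.memLp_sum (fun n => memLp_one_iff_integrable.2 ((hident n).integrable_iff.2 hξ)) t)
  have hmarkov := mul_meas_ge_le_integral_of_nonneg (ae_of_all _ fun _ => abs_nonneg _) hsum.abs
    (δ * t)
  refine le_of_mul_le_mul_left (hmarkov.trans ?_) (mul_pos hδ htpos)
  calc ∫ ω, |∑ s ∈ Finset.range t, w s ω * ξ s ω| ∂μ ≤ η * δ * t :=
        ht₀ t (le_of_max_le_left ht) w hw
    _ = δ * t * η := by ring

end UniformWeakLaw

section MaxMin

variable {M κ : ℕ} {K : ℝ} {c L : Fin M → ℝ}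

theorem exists_minInfo_eq (hκ : κ ≤ M) (c L : Fin M → ℝ) :
    ∃ U : Finset (Fin M), U.card = κ ∧ ∑ i ∈ U, c i * L i = minInfo c κ L := by
  have : Nonempty {U : Finset (Fin M) // U.card = κ} := by
    obtain ⟨U, -, hU⟩ := Finset.exists_subset_card_eq (s := (Finset.univ : Finset (Fin M)))
      (hκ.trans_eq (Finset.card_fin M).symm)
    exact ⟨⟨U, hU⟩⟩
  obtain ⟨U, hU⟩ := exists_eq_ciInf_of_finite
    (f := fun U : {U : Finset (Fin M) // U.card = κ} => ∑ i ∈ U.1, c i * L i)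
  exact ⟨U.1, U.2, hU⟩

theorem minInfo_le_maxMinValue (hκ : κ ≤ M) (hc : c ∈ frequencyDomain M K) :
    minInfo c κ L ≤ maxMinValue κ K L := by
  refine le_csSup ⟨∑ i, |L i|, ?_⟩ ⟨c, hc, rfl⟩
  rintro _ ⟨c, hc, rfl⟩
  obtain ⟨U, -, hU⟩ := exists_minInfo_eq hκ c L
  calc minInfo c κ L = ∑ i ∈ U, c i * L i := hU.symm
    _ ≤ ∑ i ∈ U, |L i| := Finset.sum_le_sum fun i _ =>
        (le_abs_self _).trans (by
          rw [abs_mul, abs_of_nonneg (hc.1 i).1]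
          exact mul_le_of_le_one_left (abs_nonneg _) (hc.1 i).2)
    _ ≤ ∑ i, |L i| :=
        Finset.sum_le_sum_of_subset_of_nonneg (Finset.subset_univ U) fun i _ _ => abs_nonneg (L i)

theorem exists_sum_le_maxMinValue_comp (hκ : κ ≤ M) (σ : Equiv.Perm (Fin M))
    (hc : c ∈ frequencyDomain M K) :
    ∃ U : Finset (Fin M), U.card = κ ∧ ∑ i ∈ U, c i * L i ≤ maxMinValue κ K (L ∘ σ) := by
  have hcσ : c ∘ σ ∈ frequencyDomain M K :=
    ⟨fun i => hc.1 (σ i), by simpa using (Equiv.sum_comp σ c).trans_le hc.2⟩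
  obtain ⟨U, hU, hmin⟩ := exists_minInfo_eq hκ (c ∘ σ) (L ∘ σ)
  refine ⟨U.map σ.toEmbedding, by simpa using hU, ?_⟩
  rw [Finset.sum_map]
  exact hmin.trans_le (minInfo_le_maxMinValue hκ hcσ)

theorem maxMinValue_pos (hκ₁ : 1 ≤ κ) (hκ : κ ≤ M) (hK : 0 < K) (hL : ∀ i, 0 < L i) :
    0 < maxMinValue κ K L := by
  have hM : (0 : ℝ) < M := Nat.cast_pos.2 (hκ₁.trans hκ)
  set q : ℝ := min 1 (K / M)
  have hq : 0 < q := lt_min one_pos (div_pos hK hM)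
  have hc : (fun _ => q) ∈ frequencyDomain M K := by
    refine ⟨fun _ => ⟨hq.le, min_le_left _ _⟩, ?_⟩
    rw [Finset.sum_const, Finset.card_fin, nsmul_eq_mul]
    exact (le_div_iff₀' hM).1 (min_le_right _ _)
  obtain ⟨U, hU, hmin⟩ := exists_minInfo_eq hκ (fun _ : Fin M => q) L
  have hUne : U.Nonempty := Finset.card_pos.1 (hκ₁.trans_eq hU.symm)
  calc 0 < ∑ i ∈ U, q * L i := Finset.sum_pos (fun i _ => mul_pos hq (hL i)) hUne
    _ ≤ maxMinValue κ K L := hmin.trans_le (minInfo_le_maxMinValue hκ hc)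

/-- The frequency with which each source is sampled during the first `n` steps when `R s` is the
set of sources sampled at time `s + 1`. -/
noncomputable def samplingFrequency (R : ℕ → Finset (Fin M)) (n : ℕ) (i : Fin M) : ℝ :=
  ({s ∈ Finset.range n | i ∈ R s} : Finset ℕ).card / n

theorem samplingFrequency_nonneg (R : ℕ → Finset (Fin M)) (n : ℕ) (i : Fin M) :
    0 ≤ samplingFrequency R n i := by
  unfold samplingFrequency
  positivity

theorem samplingFrequency_mem_frequencyDomain {R : ℕ → Finset (Fin M)} {n : ℕ}
    (hR : (∑ s ∈ Finset.range n, ((R s).card : ℝ)) / n ≤ K) :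
    samplingFrequency R n ∈ frequencyDomain M K := by
  refine ⟨fun i => ⟨samplingFrequency_nonneg R n i, ?_⟩, ?_⟩
  · refine div_le_one_of_le₀ (Nat.cast_le.2 ?_) n.cast_nonneg
    exact (Finset.card_filter_le _ _).trans_eq (Finset.card_range n)
  · have hcount : ∑ i, ({s ∈ Finset.range n | i ∈ R s} : Finset ℕ).card =
        ∑ s ∈ Finset.range n, (R s).card := by
      simp only [Finset.card_eq_sum_ones, Finset.sum_filter]
      rw [Finset.sum_comm]
      simp only [Finset.sum_ite_mem, Finset.univ_inter]
    simp only [samplingFrequency]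
    rwa [← Finset.sum_div, ← Nat.cast_sum, hcount, Nat.cast_sum]

theorem card_le_card_symmDiff_symmDiff_sdiff {ι : Type*} [DecidableEq ι] (A D U : Finset ι) :
    U.card ≤ (symmDiff (symmDiff A (U \ symmDiff A D)) D).card := by
  rw [symmDiff_right_comm]
  refine Finset.card_le_card fun i hi => ?_
  by_cases hiD : i ∈ symmDiff A D <;> simp [hi, hiD]

end MaxMin

namespace Model

variable {M : ℕ} {S Ω : Type*} [MeasurableSpace S] [mΩ : MeasurableSpace Ω] (m : Model M S Ω)
  {A B U : Finset (Fin M)} {i : Fin M} {n : ℕ} {R : ℕ → Ω → Finset (Fin M)}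

instance (A : Finset (Fin M)) : IsProbabilityMeasure (m.P A) := m.isProbabilityMeasure_P A

/-- The distribution of an observation of source `i` when `A` is the set of anomalous sources.  The
distribution for the opposite status is `m.law Aᶜ i`. -/
noncomputable def law (A : Finset (Fin M)) (i : Fin M) : Measure S :=
  if i ∈ A then m.law₁ i else m.law₀ i

theorem map_X (A : Finset (Fin M)) (i : Fin M) (n : ℕ) : (m.P A).map (m.X i n) = m.law A i := by
  rw [m.law_X, law, law₀, law₁]
  split_ifs <;> rfl

instance (A : Finset (Fin M)) (i : Fin M) : IsProbabilityMeasure (m.law A i) :=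
  m.map_X A i 0 ▸ Measure.isProbabilityMeasure_map (m.measurable_X i 0).aemeasurable

theorem ae_X_of_ae_law {p : S → Prop} (h : ∀ᵐ x ∂(m.law A i), p x) (n : ℕ) :
    ∀ᵐ ω ∂(m.P A), p (m.X i n ω) :=
  ae_of_ae_map (m.measurable_X i n).aemeasurable (by rwa [m.map_X])

theorem law_congr (h : i ∈ A ↔ i ∈ B) : m.law A i = m.law B i := by
  simp only [law, h]

theorem law_symmDiff_of_mem (hi : i ∈ U) : m.law (symmDiff A U) i = m.law Aᶜ i :=
  m.law_congr (by simp [Finset.mem_symmDiff, hi])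

theorem law_symmDiff_of_notMem (hi : i ∉ U) : m.law (symmDiff A U) i = m.law A i :=
  m.law_congr (by simp [Finset.mem_symmDiff, hi])

theorem klNumber_eq_toReal_klDiv (A : Finset (Fin M)) (i : Fin M) :
    m.klNumber A i = (InformationTheory.klDiv (m.law A i) (m.law Aᶜ i)).toReal := by
  by_cases hi : i ∈ A <;> simp [klNumber, law, klI, klJ, hi]

theorem klNumber_nonneg (A : Finset (Fin M)) (i : Fin M) : 0 ≤ m.klNumber A i :=
  m.klNumber_eq_toReal_klDiv A i ▸ ENNReal.toReal_nonneg

theorem klNumber_pos (hKL : m.KLPosFinite) (A : Finset (Fin M)) (i : Fin M) :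
    0 < m.klNumber A i := by
  obtain ⟨hI, hJ⟩ := hKL i
  rw [klNumber]
  split_ifs
  · exact ENNReal.toReal_pos hI.1.ne' hI.2.ne
  · exact ENNReal.toReal_pos hJ.1.ne' hJ.2.ne

/-- The log-likelihood ratio of one observation of source `i`, for its status in `A` against the
opposite status. -/
noncomputable def ell (A : Finset (Fin M)) (i : Fin M) : S → ℝ := llr (m.law A i) (m.law Aᶜ i)

theorem measurable_ell (A : Finset (Fin M)) (i : Fin M) : Measurable (m.ell A i) :=
  measurable_llr _ _

theorem klDiv_law_ne_top (hF : 0 < m.klNumber A i) :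
    InformationTheory.klDiv (m.law A i) (m.law Aᶜ i) ≠ ∞ := fun htop => hF.ne' <| by
  rw [m.klNumber_eq_toReal_klDiv, htop, ENNReal.toReal_top]

theorem law_absolutelyContinuous_law_compl (hF : 0 < m.klNumber A i) : m.law A i ≪ m.law Aᶜ i :=
  (InformationTheory.klDiv_ne_top_iff.1 (m.klDiv_law_ne_top hF)).1

theorem integrable_ell (hF : 0 < m.klNumber A i) : Integrable (m.ell A i) (m.law A i) :=
  (InformationTheory.klDiv_ne_top_iff.1 (m.klDiv_law_ne_top hF)).2

theorem integral_ell (hF : 0 < m.klNumber A i) :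
    ∫ x, m.ell A i x ∂(m.law A i) = m.klNumber A i := by
  rw [m.klNumber_eq_toReal_klDiv, InformationTheory.toReal_klDiv_of_measure_eq
    (m.law_absolutelyContinuous_law_compl hF) (by simp only [measure_univ])]
  rfl

theorem law_absolutelyContinuous_law_symmDiff (hF : ∀ i, 0 < m.klNumber A i)
    (U : Finset (Fin M)) (i : Fin M) : m.law A i ≪ m.law (symmDiff A U) i := by
  by_cases hi : i ∈ U
  · exact m.law_symmDiff_of_mem hi ▸ m.law_absolutelyContinuous_law_compl (hF i)
  · exact m.law_symmDiff_of_notMem hi ▸ .rfl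

/-- The information carried by all randomization variables and by the observations with indices in
`Q`. -/
@[reducible] def dataInfo (Q : Set (Fin M × ℕ)) : MeasurableSpace Ω :=
  (⨆ q ∈ Q, MeasurableSpace.comap (m.X q.1 q.2) inferInstance) ⊔
    MeasurableSpace.comap (fun ω (q : Fin M × ℕ) => m.Z q.1 q.2 ω) inferInstance

theorem measurable_Z_family : Measurable fun ω (q : Fin M × ℕ) => m.Z q.1 q.2 ω :=
  measurable_pi_lambda _ fun q => m.measurable_Z q.1 q.2

theorem dataInfo_le (Q : Set (Fin M × ℕ)) : m.dataInfo Q ≤ mΩ :=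
  sup_le (iSup₂_le fun q _ => (m.measurable_X q.1 q.2).comap_le) m.measurable_Z_family.comap_le

theorem dataInfo_mono : Monotone m.dataInfo := fun _ _ h => sup_le_sup_right (biSup_mono h) _

theorem measurable_X_dataInfo {Q : Set (Fin M × ℕ)} (h : (i, n) ∈ Q) :
    Measurable[m.dataInfo Q] (m.X i n) :=
  (comap_measurable (m.X i n)).mono (le_sup_of_le_left (le_iSup₂_of_le (i, n) h le_rfl)) le_rfl

theorem indep_dataInfo_X (A : Finset (Fin M)) {Q : Set (Fin M × ℕ)} (h : (i, n) ∉ Q) :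
    Indep (m.dataInfo Q) (MeasurableSpace.comap (m.X i n) inferInstance) (m.P A) := by
  have hX : ∀ q : Fin M × ℕ, MeasurableSpace.comap (m.X q.1 q.2) inferInstance ≤ mΩ :=
    fun q => (m.measurable_X q.1 q.2).comap_le
  have hX_indep : Indep (MeasurableSpace.comap (m.X i n) inferInstance)
      (⨆ q ∈ Q, MeasurableSpace.comap (m.X q.1 q.2) inferInstance) (m.P A) := by
    simpa only [iSup_singleton] using
      indep_iSup_of_disjoint hX (m.indep_X A).iIndep (Set.disjoint_singleton_left.2 h)
  have hcoord : ∀ q : Fin M × ℕ, MeasurableSpace.comap (m.X q.1 q.2) inferInstance ≤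
      MeasurableSpace.comap (fun ω (q : Fin M × ℕ) => m.X q.1 q.2 ω) inferInstance :=
    fun q => MeasurableSpace.comap_le_comap_pi (g := fun q => m.X q.1 q.2) q
  exact (indep_sup_comap (iSup₂_le fun q _ => hX q) m.measurable_Z_family hX_indep
    (indep_of_indep_of_le_left (m.indep_XZ A)
      (sup_le (hcoord (i, n)) (iSup₂_le fun q _ => hcoord q)))).symm

/-- The filtration generated by the first `n` observations of every source.  All randomization
variables belong to it from the start. -/
def past : Filtration ℕ mΩ where
  seq n := m.dataInfo {q | q.2 < n}
  mono' _ _ h := m.dataInfo_mono fun _ hq => lt_of_lt_of_le hq h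
  le' _ := m.dataInfo_le _

/-- The information at time `n` when the sources in `R s ω` are sampled at time `s + 1`, enlarged by
all randomization variables, past and future. -/
@[reducible] def sampledInfo (R : ℕ → Ω → Finset (Fin M)) : ℕ → MeasurableSpace Ω
  | 0 => MeasurableSpace.comap (fun ω (q : Fin M × ℕ) => m.Z q.1 q.2 ω) inferInstance
  | n + 1 => sampledInfo R n ⊔ ⨆ i ∈ Finset.univ, observedOn {ω | i ∈ R n ω} (m.X i n)

theorem sampledInfo_mono (R : ℕ → Ω → Finset (Fin M)) : Monotone (m.sampledInfo R) :=
  monotone_nat_of_le_succ fun _ => le_sup_left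

theorem info_le_sampledInfo (R : ℕ → Ω → Finset (Fin M)) (n : ℕ) :
    m.info R n ≤ m.sampledInfo R n := by
  have hZ : ∀ i n, MeasurableSpace.comap (m.Z i n) inferInstance ≤ m.sampledInfo R 0 :=
    fun i n => MeasurableSpace.comap_le_comap_pi (g := fun q => m.Z q.1 q.2) (i, n)
  induction n with
  | zero => exact iSup_le fun i => hZ i 0
  | succ n ih =>
    have hsampled : ∀ i, observedOn {ω | i ∈ R n ω} (m.X i n) ≤ m.sampledInfo R (n + 1) :=
      fun i => le_sup_of_le_right (le_iSup₂_of_le i (Finset.mem_univ i) le_rfl)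
    refine sup_le (sup_le (ih.trans le_sup_left) (iSup_le fun i => ?_))
      (MeasurableSpace.generateFrom_le ?_)
    · exact (hZ i (n + 1)).trans (m.sampledInfo_mono R (Nat.zero_le _))
    · rintro _ ⟨i, C, hC, rfl⟩
      exact hsampled i _ (measurableSet_observedOn_inter_preimage hC)

/-- The sources to be sampled at time `n + 1` are chosen on the basis of `m.sampledInfo R n`. -/
def IsSamplingRule (R : ℕ → Ω → Finset (Fin M)) : Prop :=
  ∀ n i, MeasurableSet[m.sampledInfo R n] {ω | i ∈ R n ω}

namespace IsSamplingRule

variable {m}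

theorem sup_biSup_observedOn_le_dataInfo (hR : m.IsSamplingRule R) {s : Finset (Fin M)}
    {Q : Set (Fin M × ℕ)} (hQ : m.sampledInfo R n ≤ m.dataInfo Q) (hs : ∀ i ∈ s, (i, n) ∈ Q) :
    m.sampledInfo R n ⊔ ⨆ i ∈ s, observedOn {ω | i ∈ R n ω} (m.X i n) ≤ m.dataInfo Q :=
  sup_le hQ (iSup₂_le fun i hi => observedOn_le (hQ _ (hR n i)) (m.measurable_X_dataInfo (hs i hi)))

theorem sampledInfo_le_past (hR : m.IsSamplingRule R) (n : ℕ) : m.sampledInfo R n ≤ m.past n := by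
  induction n with
  | zero => exact le_sup_right
  | succ n ih =>
    exact hR.sup_biSup_observedOn_le_dataInfo (ih.trans (m.past.mono n.le_succ))
      fun _ _ => n.lt_succ_self

theorem sampledInfo_le (hR : m.IsSamplingRule R) (n : ℕ) : m.sampledInfo R n ≤ mΩ :=
  (hR.sampledInfo_le_past n).trans (m.past.le n)

theorem indep_sup_biSup_observedOn_X (hR : m.IsSamplingRule R) (A : Finset (Fin M)) (n : ℕ)
    (s : Finset (Fin M)) (i : Fin M) (hi : i ∉ s) :
    Indep (m.sampledInfo R n ⊔ ⨆ j ∈ s, observedOn {ω | j ∈ R n ω} (m.X j n))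
      (MeasurableSpace.comap (m.X i n) inferInstance) (m.P A) := by
  refine indep_of_indep_of_le_left (m.indep_dataInfo_X A (Q := {(i, n)}ᶜ) fun h => h rfl)
    (hR.sup_biSup_observedOn_le_dataInfo
      ((hR.sampledInfo_le_past n).trans (m.dataInfo_mono fun q hq h => ?_)) fun j hj h => ?_)
  · exact hq.ne (congrArg Prod.snd h)
  · exact hi ((Prod.mk.inj h).1 ▸ hj)

end IsSamplingRule

theorem P_eq_of_measurableSet_sampledInfo_zero (A B : Finset (Fin M)) {E : Set Ω}
    (hE : MeasurableSet[m.sampledInfo R 0] E) : m.P A E = m.P B E := by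
  have hmap : ∀ A, (m.P A).map (fun ω (q : Fin M × ℕ) => m.Z q.1 q.2 ω) =
      Measure.infinitePi fun _ : Fin M × ℕ => (volume : Measure ℝ).restrict (Set.Ioo 0 1) := by
    intro A
    rw [(iIndepFun_iff_map_fun_eq_infinitePi_map
      fun q : Fin M × ℕ => m.measurable_Z q.1 q.2).1 (m.indep_Z A)]
    simp only [m.law_Z]
  obtain ⟨C, hC, rfl⟩ := hE
  rw [← Measure.map_apply m.measurable_Z_family hC, ← Measure.map_apply m.measurable_Z_family hC,
    hmap, hmap]

/-- The likelihood ratio of `A` against `B` for the observations sampled up to time `n`. -/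
noncomputable def likelihood (A B : Finset (Fin M)) (R : ℕ → Ω → Finset (Fin M)) (n : ℕ) (ω : Ω) :
    ℝ≥0∞ :=
  ∏ s ∈ Finset.range n, ∏ i ∈ R s ω, (m.law A i).rnDeriv (m.law B i) (m.X i s ω)

theorem likelihood_succ (A B : Finset (Fin M)) (R : ℕ → Ω → Finset (Fin M)) (n : ℕ) (ω : Ω) :
    m.likelihood A B R (n + 1) ω = m.likelihood A B R n ω *
      ∏ i, {ω | i ∈ R n ω}.mulIndicator ((m.law A i).rnDeriv (m.law B i) ∘ m.X i n) ω := by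
  classical
  rw [likelihood, Finset.prod_range_succ]
  simp only [Set.mulIndicator_apply, Set.mem_ofPred_eq, Function.comp_apply,
    Finset.prod_ite_mem, Finset.univ_inter]
  rfl

theorem IsSamplingRule.isLikelihoodRatioOn_likelihood {m : Model M S Ω} (hR : m.IsSamplingRule R)
    (hAB : ∀ i, m.law A i ≪ m.law B i) (n : ℕ) :
    IsLikelihoodRatioOn (m.sampledInfo R n) (m.P A) (m.P B) (m.likelihood A B R n) := by
  induction n with
  | zero =>
    refine ⟨measurable_const, fun E hE => ?_⟩
    simp [likelihood, m.P_eq_of_measurableSet_sampledInfo_zero A B hE]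
  | succ n ih =>
    rw [funext (m.likelihood_succ A B R n)]
    refine ih.sup_biSup_observedOn (m.measurable_X · n) (fun i => Measure.measurable_rnDeriv _ _)
      (fun i => ?_) (hR n) (hR.sampledInfo_le n) (hR.indep_sup_biSup_observedOn_X A n)
      (hR.indep_sup_biSup_observedOn_X B n) Finset.univ
    rw [m.map_X, m.map_X, Measure.withDensity_rnDeriv_eq _ _ (hAB i)]

/-- The log-likelihood ratio of the observations sampled from source `i` up to time `n`, for its
status in `A` against the opposite status. -/
noncomputable def sampledLLR (A : Finset (Fin M)) (R : ℕ → Ω → Finset (Fin M)) (i : Fin M) (n : ℕ)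
    (ω : Ω) : ℝ :=
  ∑ s ∈ Finset.range n with i ∈ R s ω, m.ell A i (m.X i s ω)

theorem rnDeriv_law_symmDiff_ae_eq (hF : ∀ i, 0 < m.klNumber A i) (U : Finset (Fin M))
    (i : Fin M) : ∀ᵐ x ∂(m.law A i), (m.law A i).rnDeriv (m.law (symmDiff A U) i) x =
      if i ∈ U then ENNReal.ofReal (Real.exp (m.ell A i x)) else 1 := by
  split_ifs with hi
  · have hac := m.law_absolutelyContinuous_law_compl (hF i)
    rw [m.law_symmDiff_of_mem hi]
    filter_upwards [exp_llr_of_ac _ _ hac,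
      hac.ae_le (Measure.rnDeriv_lt_top (m.law A i) _)] with x hx htop
    rw [ell, hx, ENNReal.ofReal_toReal htop.ne]
  · rw [m.law_symmDiff_of_notMem hi]
    exact Measure.rnDeriv_self _

theorem likelihood_symmDiff_ae_eq (hF : ∀ i, 0 < m.klNumber A i) (U : Finset (Fin M))
    (R : ℕ → Ω → Finset (Fin M)) (n : ℕ) : ∀ᵐ ω ∂(m.P A), m.likelihood A (symmDiff A U) R n ω =
      ENNReal.ofReal (Real.exp (∑ i ∈ U, m.sampledLLR A R i n ω)) := by
  have hX : ∀ᵐ ω ∂(m.P A), ∀ i s,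
      (m.law A i).rnDeriv (m.law (symmDiff A U) i) (m.X i s ω) =
        if i ∈ U then ENNReal.ofReal (Real.exp (m.ell A i (m.X i s ω))) else 1 :=
    ae_all_iff.2 fun i => ae_all_iff.2 fun s =>
      m.ae_X_of_ae_law (m.rnDeriv_law_symmDiff_ae_eq hF U i) s
  filter_upwards [hX] with ω hω
  have hsum : ∑ i ∈ U, m.sampledLLR A R i n ω =
      ∑ s ∈ Finset.range n, ∑ i ∈ R s ω, if i ∈ U then m.ell A i (m.X i s ω) else 0 := by
    simp only [sampledLLR, Finset.sum_filter]
    rw [Finset.sum_comm]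
    simp only [Finset.sum_ite_mem, Finset.inter_comm]
  simp only [likelihood, hω, hsum, Real.exp_sum, Finset.prod_ite_mem, Finset.sum_ite_mem]
  rw [ENNReal.ofReal_prod_of_nonneg fun s _ => Finset.prod_nonneg fun i _ => (Real.exp_pos _).le]
  simp only [ENNReal.ofReal_prod_of_nonneg fun _ _ => (Real.exp_pos _).le]

theorem IsSamplingRule.P_inter_sum_sampledLLR_le {m : Model M S Ω} (hR : m.IsSamplingRule R)
    (hF : ∀ i, 0 < m.klNumber A i) (U : Finset (Fin M)) {E : Set Ω}
    (hE : MeasurableSet[m.sampledInfo R n] E) (a : ℝ) :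
    m.P A (E ∩ {ω | ∑ i ∈ U, m.sampledLLR A R i n ω ≤ a}) ≤
      ENNReal.ofReal (Real.exp a) * m.P (symmDiff A U) E := by
  have hL := hR.isLikelihoodRatioOn_likelihood (m.law_absolutelyContinuous_law_symmDiff hF U) n
  refine (measure_mono_ae ?_).trans (hL.measure_inter_le hE _)
  filter_upwards [m.likelihood_symmDiff_ae_eq hF U R n] with ω hω h
  refine ⟨h.1, ?_⟩
  rw [Set.mem_ofPred_eq, hω]
  exact ENNReal.ofReal_le_ofReal (Real.exp_le_exp.2 h.2)

end Model

namespace Model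

variable {M : ℕ} {S Ω : Type*} [MeasurableSpace S] [mΩ : MeasurableSpace Ω] {m : Model M S Ω}
  {A : Finset (Fin M)} {i : Fin M} {k n t : ℕ} {K α δ η : ℝ} {ω : Ω}

theorem exists_measureReal_abs_predictable_sum_ell_ge_le (hF : 0 < m.klNumber A i) (hδ : 0 < δ)
    (hη : 0 < η) : ∃ t₀ : ℕ, ∀ t ≥ t₀, ∀ w, IsPredictableWeight m.past w →
      (m.P A).real {ω | δ * t ≤
        |∑ s ∈ Finset.range t, w s ω * (m.ell A i (m.X i s ω) - m.klNumber A i)|} ≤ η := by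
  have hell : Measurable fun x => m.ell A i x - m.klNumber A i :=
    (m.measurable_ell A i).sub_const _
  have hint : Integrable (fun x => m.ell A i x - m.klNumber A i) (m.law A i) :=
    (m.integrable_ell hF).sub (integrable_const _)
  have hmean : ∫ x, (m.ell A i x - m.klNumber A i) ∂(m.law A i) = 0 := by
    rw [integral_sub (m.integrable_ell hF) (integrable_const _), m.integral_ell hF]
    simp
  rw [← m.map_X A i 0] at hint hmean
  rw [integral_map (m.measurable_X i 0).aemeasurable hell.aestronglyMeasurable] at hmean
  refine exists_measureReal_abs_predictable_sum_ge_le (fun n => ?_) (fun n => ?_) (fun n => ?_)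
    (hint.comp_measurable (m.measurable_X i 0)) hmean hδ hη
  · exact hell.comp (m.measurable_X_dataInfo n.lt_succ_self)
  · exact indep_of_indep_of_le_right (m.indep_dataInfo_X A (lt_irrefl n))
      (hell.comp (comap_measurable (m.X i n))).comap_le
  · have hX : IdentDistrib (m.X i n) (m.X i 0) (m.P A) (m.P A) :=
      ⟨(m.measurable_X i n).aemeasurable, (m.measurable_X i 0).aemeasurable, by
        rw [m.map_X, m.map_X]⟩
    exact hX.comp hell

namespace Policy

theorem isSamplingRule (p : m.Policy) : m.IsSamplingRule p.R := fun n i => by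
  have hmem : {ω | i ∈ p.R n ω} = ⋃ D : {D : Finset (Fin M) // i ∈ D}, {ω | p.R n ω = D.1} := by
    ext ω
    simp
  rw [hmem]
  exact MeasurableSet.iUnion fun D => m.info_le_sampledInfo p.R n _ (p.sampling_rule n D)

theorem measurableSet_T_le (p : m.Policy) (t : ℕ) :
    MeasurableSet[m.sampledInfo p.R t] {ω | p.T ω ≤ t} := by
  have hT : {ω | p.T ω ≤ t} = ⋃ n : {n : ℕ // n ≤ t}, {ω | p.T ω = n.1} := by
    ext ω
    simp only [Set.mem_ofPred_eq, Set.mem_iUnion]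
    refine ⟨fun h => ?_, fun ⟨⟨n, hn⟩, h⟩ => h ▸ Nat.cast_le.2 hn⟩
    obtain ⟨n, hn, hnt⟩ := ENat.le_natCast_iff.1 h
    exact ⟨⟨n, hnt⟩, hn⟩
  rw [hT]
  exact MeasurableSet.iUnion fun n =>
    m.sampledInfo_mono p.R n.2 _ (m.info_le_sampledInfo p.R n _ (p.stopping_rule n))

/-- The event that source `i` is sampled at time `s + 1`, before or upon stopping. -/
def selected (p : m.Policy) (i : Fin M) (s : ℕ) : Set Ω := {ω | i ∈ p.R s ω ∧ s < p.T ω}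

theorem isPredictableWeight_selected (p : m.Policy) (i : Fin M) :
    IsPredictableWeight m.past fun s => (p.selected i s).indicator 1 where
  measurable s := by
    have hselected : p.selected i s = {ω | i ∈ p.R s ω} ∩ {ω | p.T ω ≤ s}ᶜ := by
      ext ω
      simp [selected]
    have hle := p.isSamplingRule.sampledInfo_le_past s
    have hone : Measurable[m.past s] (1 : Ω → ℝ) := measurable_const
    refine Measurable.indicator hone ?_
    rw [hselected]
    exact (hle _ (p.isSamplingRule s i)).inter (hle _ (p.measurableSet_T_le s)).compl
  abs_le_one s ω := by
    by_cases hω : ω ∈ p.selected i s <;> simp [hω]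

/-- The deviation, at time `t`, of the log-likelihood ratio of the observations sampled from source
`i` before stopping from its predictable compensator. -/
noncomputable def fluctuation (p : m.Policy) (A : Finset (Fin M)) (i : Fin M) (t : ℕ) (ω : Ω) : ℝ :=
  ∑ s ∈ Finset.range t, (p.selected i s).indicator 1 ω * (m.ell A i (m.X i s ω) - m.klNumber A i)

theorem fluctuation_eq_of_T_eq (p : m.Policy) (A : Finset (Fin M)) (i : Fin M)
    (hT : p.T ω = n) (hn : n ≤ t) : p.fluctuation A i t ω =
      m.sampledLLR A p.R i n ω - n * samplingFrequency (p.R · ω) n i * m.klNumber A i := by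
  classical
  have hn0 : (n : ℝ) ≠ 0 := by
    have h1 := p.one_le_T ω
    rw [hT, Nat.one_le_cast] at h1
    positivity
  have hselected : ∀ s, ω ∈ p.selected i s ↔ s < n ∧ i ∈ p.R s ω := fun s => by
    simp [selected, hT, and_comm]
  have hfilter : {s ∈ Finset.range t | s < n ∧ i ∈ p.R s ω} =
      ({s ∈ Finset.range n | i ∈ p.R s ω} : Finset ℕ) := by
    ext s
    simp only [Finset.mem_filter, Finset.mem_range]
    exact ⟨fun h => h.2, fun h => ⟨h.1.trans_le hn, h⟩⟩
  simp only [fluctuation, Set.indicator_apply, hselected, Pi.one_apply, ite_mul, one_mul, zero_mul]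
  rw [← Finset.sum_filter, hfilter, Finset.sum_sub_distrib, Finset.sum_const, nsmul_eq_mul,
    samplingFrequency, mul_div_cancel₀ _ hn0, sampledLLR]

/-- The event that a policy stops at time `n` and misclassifies at least `k` sources when `B` is the
set of anomalous sources. -/
def errorAt (p : m.Policy) (B : Finset (Fin M)) (k n : ℕ) : Set Ω :=
  {ω | p.T ω = n ∧ k ≤ (symmDiff B (p.Δ ω)).card}

theorem measurableSet_errorAt (p : m.Policy) (B : Finset (Fin M)) (k n : ℕ) :
    MeasurableSet[m.sampledInfo p.R n] (p.errorAt B k n) := by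
  have herror : p.errorAt B k n = ⋃ D : {D : Finset (Fin M) // k ≤ (symmDiff B D).card},
      {ω | p.T ω = n ∧ p.Δ ω = D.1} := by
    ext ω
    simp [errorAt]
  rw [herror]
  exact MeasurableSet.iUnion fun D => m.info_le_sampledInfo p.R n _ (p.decision_rule n D)

theorem sum_P_errorAt_le {p : m.Policy} (hp : p.ErrorConstraint α k) (B : Finset (Fin M))
    (s : Finset ℕ) : ∑ n ∈ s, m.P B (p.errorAt B k n) ≤ ENNReal.ofReal α := by
  have hdisj : Pairwise (Function.onFun Disjoint (p.errorAt B k)) := fun n n' hne =>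
    Set.disjoint_left.2 fun ω h h' => hne (Nat.cast_injective (h.1.symm.trans h'.1))
  rw [← measure_biUnion_finset (hdisj.set_pairwise _) fun n _ =>
    p.isSamplingRule.sampledInfo_le n _ (p.measurableSet_errorAt B k n)]
  refine (measure_mono ?_).trans (hp B)
  exact Set.iUnion₂_subset fun n _ ω hω => ⟨hω.1 ▸ ENat.natCast_ne_top n, hω.2⟩

/-- The event that a policy stops by time `t` with at least `k` errors with respect to `A ∆ U`,
while the log-likelihood ratio of `A` against `A ∆ U` is at most `a`. -/
def confusion (p : m.Policy) (A U : Finset (Fin M)) (k t : ℕ) (a : ℝ) : Set Ω :=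
  ⋃ n ∈ Finset.range (t + 1), p.errorAt (symmDiff A U) k n ∩
    {ω | ∑ i ∈ U, m.sampledLLR A p.R i n ω ≤ a}

theorem P_confusion_le {p : m.Policy} (hp : p.ErrorConstraint α k) (hF : ∀ i, 0 < m.klNumber A i)
    (U : Finset (Fin M)) (t : ℕ) (a : ℝ) :
    m.P A (p.confusion A U k t a) ≤ ENNReal.ofReal (Real.exp a * α) :=
  calc m.P A (p.confusion A U k t a)
      ≤ ∑ n ∈ Finset.range (t + 1), m.P A (p.errorAt (symmDiff A U) k n ∩
          {ω | ∑ i ∈ U, m.sampledLLR A p.R i n ω ≤ a}) := measure_biUnion_finset_le _ _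
    _ ≤ ∑ n ∈ Finset.range (t + 1), ENNReal.ofReal (Real.exp a) *
          m.P (symmDiff A U) (p.errorAt (symmDiff A U) k n) :=
        Finset.sum_le_sum fun n _ =>
          p.isSamplingRule.P_inter_sum_sampledLLR_le hF U (p.measurableSet_errorAt _ k n) a
    _ ≤ ENNReal.ofReal (Real.exp a * α) := by
        rw [← Finset.mul_sum, ENNReal.ofReal_mul (Real.exp_pos a).le]
        gcongr
        exact sum_P_errorAt_le hp _ _

theorem sum_sampledLLR_le (p : m.Policy) {U V : Finset (Fin M)} (hUV : U ⊆ V) (hδ : 0 ≤ δ)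
    (hT : p.T ω = n) (hn : n ≤ t) (hsmall : ∀ i, p.fluctuation A i t ω ≤ δ * t) :
    ∑ i ∈ U, m.sampledLLR A p.R i n ω ≤
      n * ∑ i ∈ V, samplingFrequency (p.R · ω) n i * m.klNumber A i + M * (δ * t) := by
  have hcard : (U.card : ℝ) ≤ M := Nat.cast_le.2 (card_finset_fin_le U)
  calc ∑ i ∈ U, m.sampledLLR A p.R i n ω
      ≤ ∑ i ∈ U, (n * (samplingFrequency (p.R · ω) n i * m.klNumber A i) + δ * t) :=
        Finset.sum_le_sum fun i _ => by
          have hi := hsmall i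
          rw [p.fluctuation_eq_of_T_eq A i hT hn] at hi
          linarith
    _ = n * ∑ i ∈ U, samplingFrequency (p.R · ω) n i * m.klNumber A i + U.card * (δ * t) := by
        rw [Finset.sum_add_distrib, Finset.mul_sum, Finset.sum_const, nsmul_eq_mul]
    _ ≤ n * ∑ i ∈ V, samplingFrequency (p.R · ω) n i * m.klNumber A i + M * (δ * t) := by
        have hsum := Finset.sum_le_sum_of_subset_of_nonneg hUV fun i _ _ =>
          mul_nonneg (samplingFrequency_nonneg (p.R · ω) n i) (m.klNumber_nonneg A i)
        gcongr

theorem exists_mem_confusion (p : m.Policy) (hkM : k ≤ M) (hδ : 0 ≤ δ) (hT : p.T ω = n)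
    (hn : n ≤ t) (hK : (∑ s ∈ Finset.range n, ((p.R s ω).card : ℝ)) / n ≤ K)
    (hsmall : ∀ i, p.fluctuation A i t ω ≤ δ * t) :
    ∃ U, ω ∈ p.confusion A U k t (maxMinValue k K (m.orderedKL A) * t + M * (δ * t)) := by
  obtain ⟨V, hV, hmin⟩ := exists_sum_le_maxMinValue_comp (L := m.klNumber A) hkM
    (Tuple.sort (m.klNumber A)) (samplingFrequency_mem_frequencyDomain hK)
  refine ⟨V \ symmDiff A (p.Δ ω), Set.mem_iUnion₂.2
    ⟨n, Finset.mem_range.2 (Nat.lt_succ_of_le hn), ⟨hT, ?_⟩, ?_⟩⟩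
  · exact hV ▸ card_le_card_symmDiff_symmDiff_sdiff A (p.Δ ω) V
  · calc ∑ i ∈ V \ symmDiff A (p.Δ ω), m.sampledLLR A p.R i n ω
        ≤ n * ∑ i ∈ V, samplingFrequency (p.R · ω) n i * m.klNumber A i + M * (δ * t) :=
          p.sum_sampledLLR_le Finset.sdiff_subset hδ hT hn hsmall
      _ ≤ t * maxMinValue k K (m.orderedKL A) + M * (δ * t) := by
          exact add_le_add_left (mul_le_mul (Nat.cast_le.2 hn) hmin
            (Finset.sum_nonneg fun i _ => mul_nonneg (samplingFrequency_nonneg _ _ _)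
              (m.klNumber_nonneg A i)) t.cast_nonneg) _
      _ = maxMinValue k K (m.orderedKL A) * t + M * (δ * t) := by ring

theorem measureReal_T_le_le {p : m.Policy} (hp : p ∈ m.admissible α k K) (hα : 0 ≤ α)
    (hF : ∀ i, 0 < m.klNumber A i) (hkM : k ≤ M) (hδ : 0 ≤ δ)
    (hlarge : ∀ i, (m.P A).real {ω | δ * t ≤ |p.fluctuation A i t ω|} ≤ η) :
    (m.P A).real {ω | p.T ω ≤ t} ≤ 2 ^ M *
      (Real.exp (maxMinValue k K (m.orderedKL A) * t + M * (δ * t)) * α) + M * η := by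
  set a := maxMinValue k K (m.orderedKL A) * t + M * (δ * t)
  have hcover : {ω | p.T ω ≤ t} ≤ᵐ[m.P A] ((⋃ U, p.confusion A U k t a) ∪
      ⋃ i, {ω | δ * t ≤ |p.fluctuation A i t ω|} : Set Ω) := by
    filter_upwards [hp.1 A] with ω hω hTt
    obtain ⟨n, hn, hnt⟩ := ENat.le_natCast_iff.1 hTt
    by_cases hlargeω : ∃ i, δ * t ≤ |p.fluctuation A i t ω|
    · exact Or.inr (Set.mem_iUnion.2 hlargeω)
    · push Not at hlargeω
      exact Or.inl (Set.mem_iUnion.2 (p.exists_mem_confusion hkM hδ hn hnt (hω n hn)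
        fun i => (le_abs_self _).trans (hlargeω i).le))
  have hconfusion : (m.P A).real (⋃ U, p.confusion A U k t a) ≤ 2 ^ M * (Real.exp a * α) := by
    refine (measureReal_iUnion_fintype_le _).trans ?_
    refine (Finset.sum_le_card_nsmul _ _ (Real.exp a * α) fun U _ => ?_).trans_eq (by simp)
    exact ENNReal.toReal_le_of_le_ofReal (by positivity) (P_confusion_le hp.2 hF U t a)
  have hfluctuation : (m.P A).real (⋃ i, {ω | δ * t ≤ |p.fluctuation A i t ω|}) ≤ M * η := by
    refine (measureReal_iUnion_fintype_le _).trans ?_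
    exact (Finset.sum_le_card_nsmul _ _ η fun i _ => hlarge i).trans_eq (by simp)
  calc (m.P A).real {ω | p.T ω ≤ t} ≤ (m.P A).real ((⋃ U, p.confusion A U k t a) ∪
        ⋃ i, {ω | δ * t ≤ |p.fluctuation A i t ω|}) :=
        ENNReal.toReal_mono (measure_ne_top _ _) (measure_mono_ae hcover)
    _ ≤ 2 ^ M * (Real.exp a * α) + M * η :=
        (measureReal_union_le _ _).trans (add_le_add hconfusion hfluctuation)

theorem ofReal_mul_one_sub_measureReal_T_le_le_lintegral (p : m.Policy) (A : Finset (Fin M))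
    (t : ℕ) : ENNReal.ofReal ((t + 1) * (1 - (m.P A).real {ω | p.T ω ≤ t})) ≤
      ∫⁻ ω, ((p.T ω : ℕ∞) : ℝ≥0∞) ∂(m.P A) := by
  have hm : MeasurableSet {ω | p.T ω ≤ t} :=
    p.isSamplingRule.sampledInfo_le t _ (p.measurableSet_T_le t)
  rw [← probReal_compl_eq_one_sub hm, ENNReal.ofReal_mul (by positivity), ofReal_measureReal,
    ← lintegral_indicator_const hm.compl]
  refine lintegral_mono fun ω => Set.indicator_apply_le' (fun hω => ?_) fun _ => zero_le
  have hlt : (t : ℕ∞) < p.T ω := by simpa using hω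
  calc ENNReal.ofReal ((t : ℝ) + 1) = ((t + 1 : ℕ) : ℝ≥0∞) := by
        rw [← Nat.cast_succ, ENNReal.ofReal_natCast]
    _ ≤ ((p.T ω : ℕ∞) : ℝ≥0∞) := by exact_mod_cast ENat.toENNReal_le.2 (Order.add_one_le_of_lt hlt)

end Policy

end Model

section Asymptotics

theorem tendsto_abs_log_nhdsGT_zero : Tendsto (fun α : ℝ => |Real.log α|) (𝓝[>] 0) atTop :=
  tendsto_abs_atBot_atTop.comp Real.tendsto_log_nhdsGT_zero

theorem eventually_exp_abs_log_eq_inv :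
    ∀ᶠ α : ℝ in 𝓝[>] 0, Real.exp |Real.log α| = α⁻¹ := by
  filter_upwards [self_mem_nhdsWithin, Ioo_mem_nhdsGT one_pos] with α hα hα1
  rw [abs_of_neg (Real.log_neg hα hα1.2), Real.exp_neg, Real.exp_log hα]

namespace Model

variable {M : ℕ} {S Ω : Type*} [MeasurableSpace S] [MeasurableSpace Ω] {m : Model M S Ω}
  {A : Finset (Fin M)} {k : ℕ} {K : ℝ}

theorem eventually_measureReal_T_le_floor_le (hF : ∀ i, 0 < m.klNumber A i) (hk : 1 ≤ k)
    (hkM : k ≤ M) (hV : 0 < maxMinValue k K (m.orderedKL A)) {ε : ℝ} (hε : 0 < ε) (hε1 : ε < 1) :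
    ∀ᶠ α : ℝ in 𝓝[>] 0, ∀ p ∈ m.admissible α k K, (m.P A).real {ω | p.T ω ≤
      ⌊(1 - ε) * (|Real.log α| / maxMinValue k K (m.orderedKL A))⌋₊} ≤ ε := by
  set V := maxMinValue k K (m.orderedKL A)
  have hM : (0 : ℝ) < M := Nat.cast_pos.2 (hk.trans hkM)
  have hε1' : 0 < 1 - ε := sub_pos.2 hε1
  set δ : ℝ := ε * V / (2 * M) with hδ
  set η : ℝ := ε / (2 * M) with hη
  choose t₀ ht₀ using fun i => exists_measureReal_abs_predictable_sum_ell_ge_le (hF i)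
    (show 0 < δ by positivity) (show 0 < η by positivity)
  have htime : Tendsto (fun α : ℝ => (1 - ε) * (|Real.log α| / V)) (𝓝[>] 0) atTop :=
    (tendsto_abs_log_nhdsGT_zero.atTop_div_const hV).const_mul_atTop hε1'
  have hexp : Tendsto (fun α : ℝ => 2 ^ M * Real.exp (-(ε / 2 * |Real.log α|))) (𝓝[>] 0)
      (𝓝 0) := by
    simpa using (Real.tendsto_exp_neg_atTop_nhds_zero.comp
      (tendsto_abs_log_nhdsGT_zero.const_mul_atTop (half_pos hε))).const_mul (2 ^ M : ℝ)
  filter_upwards [eventually_all.2 fun i => htime.eventually_ge_atTop (t₀ i : ℝ),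
    hexp.eventually_le_const (half_pos hε), eventually_exp_abs_log_eq_inv,
    self_mem_nhdsWithin] with α hlarge hsmall hinv hα p hp
  have hα : 0 < α := hα
  set l := |Real.log α|
  set t := ⌊(1 - ε) * (l / V)⌋₊
  have hexponent : V * t + M * (δ * t) ≤ l - ε / 2 * l := by
    have hVt : V * t ≤ (1 - ε) * l :=
      calc V * t ≤ V * ((1 - ε) * (l / V)) := by gcongr; exact Nat.floor_le (by positivity)
        _ = (1 - ε) * l := by field_simp
    calc V * t + M * (δ * t) = (1 + ε / 2) * (V * t) := by rw [hδ]; field_simp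
      _ ≤ (1 + ε / 2) * ((1 - ε) * l) := by gcongr
      _ ≤ l - ε / 2 * l := by nlinarith [mul_nonneg (sq_nonneg ε) (abs_nonneg (Real.log α))]
  calc (m.P A).real {ω | p.T ω ≤ t}
      ≤ 2 ^ M * (Real.exp (V * t + M * (δ * t)) * α) + M * η :=
        Policy.measureReal_T_le_le hp hα.le hF hkM (by positivity) fun i =>
          ht₀ i t (Nat.le_floor (hlarge i)) _ (p.isPredictableWeight_selected i)
    _ ≤ 2 ^ M * (Real.exp (l - ε / 2 * l) * α) + M * η := by gcongr
    _ = 2 ^ M * Real.exp (-(ε / 2 * l)) + ε / 2 := by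
        rw [sub_eq_add_neg, Real.exp_add, hinv, hη]
        field_simp
    _ ≤ ε := by linarith

theorem eventually_ofReal_mul_le_optimalTime (hF : ∀ i, 0 < m.klNumber A i) (hk : 1 ≤ k)
    (hkM : k ≤ M) (hV : 0 < maxMinValue k K (m.orderedKL A)) {ε : ℝ} (hε : 0 < ε) (hε1 : ε < 1) :
    ∀ᶠ α : ℝ in 𝓝[>] 0, ENNReal.ofReal ((1 - ε) ^ 2 *
      (|Real.log α| / maxMinValue k K (m.orderedKL A))) ≤ m.optimalTime A α k K := by
  filter_upwards [eventually_measureReal_T_le_floor_le hF hk hkM hV hε hε1] with α hα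
  set x := |Real.log α| / maxMinValue k K (m.orderedKL A)
  have hε1' : 0 ≤ 1 - ε := (sub_pos.2 hε1).le
  refine le_iInf₂ fun p hp => (ENNReal.ofReal_le_ofReal ?_).trans
    (p.ofReal_mul_one_sub_measureReal_T_le_le_lintegral A ⌊(1 - ε) * x⌋₊)
  calc (1 - ε) ^ 2 * x = (1 - ε) * x * (1 - ε) := by ring
    _ ≤ (⌊(1 - ε) * x⌋₊ + 1) * (1 - (m.P A).real {ω | p.T ω ≤ ⌊(1 - ε) * x⌋₊}) :=
        mul_le_mul (Nat.lt_floor_add_one _).le (sub_le_sub_left (hα p hp) 1) hε1' (by positivity)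

end Model

end Asymptotics

end AnomalyId

/-- `m.klNumber A i` is `0` where the divergence is infinite, since `ENNReal.toReal ∞ = 0`: a
positive value is a finite divergence. -/
theorem mainTheorem3_general {M : ℕ} {S Ω : Type*} [MeasurableSpace S] [MeasurableSpace Ω]
    (m : AnomalyId.Model M S Ω) (A : Finset (Fin M)) (hF : ∀ i, 0 < m.klNumber A i)
    (k : ℕ) (hk : 1 ≤ k) (hkM : k ≤ M) (K : ℝ) (hK : 0 < K) :
    1 ≤ liminf (fun α : ℝ => m.optimalTime A α k K /
        ENNReal.ofReal (|Real.log α| / AnomalyId.maxMinValue k K (m.orderedKL A))) (𝓝[>] 0) := by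
  have hV : 0 < AnomalyId.maxMinValue k K (m.orderedKL A) :=
    AnomalyId.maxMinValue_pos hk hkM hK fun i => hF _
  have hfraction (ε : ℝ) (hε : ε ∈ Set.Ioo 0 1) : ENNReal.ofReal ((1 - ε) ^ 2) ≤
      liminf (fun α : ℝ => m.optimalTime A α k K /
        ENNReal.ofReal (|Real.log α| / AnomalyId.maxMinValue k K (m.orderedKL A))) (𝓝[>] 0) := by
    refine le_liminf_of_le (by isBoundedDefault) ?_
    filter_upwards [AnomalyId.Model.eventually_ofReal_mul_le_optimalTime hF hk hkM hV hε.1 hε.2,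
      AnomalyId.tendsto_abs_log_nhdsGT_zero.eventually_gt_atTop 0] with α hα hlog
    rwa [ENNReal.le_div_iff_mul_le (Or.inl (ENNReal.ofReal_pos.2 (div_pos hlog hV)).ne')
      (Or.inl ENNReal.ofReal_ne_top), ← ENNReal.ofReal_mul (sq_nonneg _)]
  have hlimit : Tendsto (fun ε : ℝ => ENNReal.ofReal ((1 - ε) ^ 2)) (𝓝[>] 0) (𝓝 1) := by
    refine Tendsto.mono_left ?_ nhdsWithin_le_nhds
    have hcont : Continuous fun ε : ℝ => ENNReal.ofReal ((1 - ε) ^ 2) :=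
      ENNReal.continuous_ofReal.comp (by fun_prop)
    simpa using hcont.tendsto 0
  exact le_of_tendsto hlimit (mem_of_superset (Ioo_mem_nhdsGT one_pos) hfraction)

theorem mainTheorem3 {M : ℕ} {S Ω : Type*} [MeasurableSpace S] [MeasurableSpace Ω]
    (m : AnomalyId.Model M S Ω) (hKL : m.KLPosFinite) (hmom : m.LLogLMoment)
    (k : ℕ) (hk : 1 ≤ k) (hkM : k ≤ M) (K : ℝ) (hK : 0 < K) (hKM : K ≤ M)
    (A : Finset (Fin M)) :
    1 ≤ liminf (fun α : ℝ => m.optimalTime A α k K /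
        ENNReal.ofReal (|Real.log α| / AnomalyId.maxMinValue k K (m.orderedKL A))) (𝓝[>] 0) :=
  mainTheorem3_general m A (AnomalyId.Model.klNumber_pos m hKL A) k hk hkM K hK
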